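/- **Setting.** A binary classification task consists of a dataset $x_1,\dots,x_n$ ($n\ge 1$) in a set $\mathcal X$, hidden arbitrary labels $y_1,\dots,y_n\in\{0,1\}$, and a nonempty class $H$ of classifiers $h:\mathcal X\to\{0,1\}$ of finite VC dimension $V_H$. The points and $H$ are known; a label is revealed only when it is queried. For a set $T$ of indices let $\mathrm{err}_T(h)=\frac1{|T|}|\{i\in T: h(x_i)\ne y_i\}|$, and write $\mathrm{err}(h)$ when $T$ is the whole dataset. A classifier $h\in H$ is $(1+\epsilon)$-approximate if $\mathrm{err}(h)\le(1+\epsilon)\min_{h'\in H}\mathrm{err}(h')$. Let $D(h,h')=\frac1n|\{i:h(x_i)\ne h'(x_i)\}|$; for $V\subseteq H$ let $B_V(h,r)=\{h'\in V: D(h,h')\le r\}$, let $\mathrm{DIS}(V)$ be the set of $i$ such that $h_1(x_i)\neq h_2(x_i)$ for some $h_1,h_2\in V$, and let $\mathrm{radius}(V)=\min\{r:\exists h'\in V,\ V\subseteq B_V(h',r)\}$. The disagreement coefficient is $$\theta=\sup_{h\in H}\ \sup_{r>0}\frac{|\mathrm{DIS}(B_H(h,r))|}{rn}.$$ **Algorithm**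 (constants $c_1,b_1,c_2,b_2$, parameters $\epsilon,\delta$). For a sample $T$ with queried labels and a width $w$ put $\mathrm{LB}_w(T,h)=\mathrm{err}_T(h)-\frac w2$ and $\mathrm{UB}_w(T,h)=\mathrm{err}_T(h)+\frac w2$. Let $\delta'=\delta/(2\log_2(2n))$, $$m_1=\Big\lceil c_1\theta^2\big(V_H\ln\theta+\ln\tfrac1{\delta'}\big)+b_1\Big\rceil,\qquad m_2=\Big\lceil \tfrac{c_2\theta^2}{\epsilon^2}\big(V_H\ln\tfrac\theta\epsilon+\ln\tfrac1\delta\big)+b_2\Big\rceil,\qquad w_1=\frac1{16\theta},\qquad w_2=\frac{\epsilon}{16\theta}.$$ Start with $H_0=H$, $r_0=1$. While $\mathrm{DIS}(H_i)\ne\emptyset$ (that is, more than one classifier is left, up to agreement on the dataset): 1. draw a uniformly random subset $S_i$ of $\mathrm{DIS}(H_i)$ of size $\min(m_1,|\mathrm{DIS}(H_i)|)$ and query its labels; 2. let $\beta=\min_{h\in H_i}\mathrm{UB}_{w_1}(S_i,h)$, $H_{i+1}=\{h\in H_i:\mathrm{LB}_{w_1}(S_i,h)\le\beta\}$ and $r_{i+1}=\mathrm{radius}(H_{i+1})$;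 3. if $r_{i+1}>r_i/2$, draw a uniformly random subset $S'$ of $\mathrm{DIS}(H_i)$ of size $\min(m_2,|\mathrm{DIS}(H_i)|)$, query its labels and return some $h\in H_i$ that minimizes $\mathrm{UB}_{w_2}(S',h)$ over $H_i$. When the loop ends without such a return, return a classifier in the current $H_i$. **Theorem.** There are universal constants $c_1,b_1,c_2,b_2,C>0$ such that, for every binary classification task as above and all $0<\epsilon\le1$ and $0<\delta<1$, the algorithm returns a $(1+\epsilon)$-approximate classifier with probability greater than $1-\delta$. Moreover, if $n\ge3$, it always makes at most $$C\left(\ln(n)\,\theta^2\Big(V_H\ln\theta+\ln\frac{\ln n}{\delta}\Big)+\frac{\theta^2}{\epsilon^2}\Big(V_H\ln\frac\theta\epsilon+\ln\frac1\delta\Big)\right)$$ label queries. (If all classifiers in $H$ agree on the dataset, then $\theta=0$, the bound is read as $0$, and no label is queried.) -/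

import Mathlib

noncomputable section

namespace ActiveLearning

/-! ### Randomized algorithms with label queries -/

/-- A randomized algorithm with output in `α` whose only access to the hidden labels of the points
`i : ι` is through label queries. It may also draw a uniformly random subset of a given size. -/
inductive LabelAlg (ι : Type) (α : Type*) where
  /-- stop and return a value -/
  | ret (a : α) : LabelAlg ι α
  /-- query the label of the point `i` and go on with the answer -/
  | query (i : ι) (k : Bool → LabelAlg ι α) : LabelAlg ι α
  /-- draw `m` distinct elements of `R` at random (all of `R` if `R` has at most `m` elements) -/
  | draw (R : Finset ι) (m : ℕ) (k : Finset ι → LabelAlg ι α) : LabelAlg ι α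

/-- The uniform distribution on the subsets of `R` of size `m` (on `{R}` if `R` has at most `m`
elements). -/
def uniformSubset {ι : Type} (R : Finset ι) (m : ℕ) : PMF (Finset ι) :=
  PMF.uniformOfFinset (R.powersetCard (min m R.card))
    (Finset.powersetCard_nonempty.2 (min_le_right _ _))

/-- The joint law of the returned value and of the total number of label queries, when the hidden
labels are `y`. -/
def LabelAlg.run {ι : Type} {α : Type*} (y : ι → Bool) : LabelAlg ι α → PMF (α × ℕ)
  | .ret a => PMF.pure (a, 0)
  | .query i k => ((k (y i)).run y).map fun p => (p.1, p.2 + 1)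
  | .draw R m k => (uniformSubset R m).bind fun T => (k T).run y

open Classical in
/-- Query the labels of all points of a list and record the answers in the table `g` (which holds
meaningless values at points that were not queried), then go on with the table. -/
def queryAll {ι : Type} {α : Type*} :
    List ι → (ι → Bool) → ((ι → Bool) → LabelAlg ι α) → LabelAlg ι α
  | [], g, k => k g
  | i :: l, g, k => .query i fun b => queryAll l (Function.update g i b) k

/-- Draw a uniformly random subset `T` of `R` of size `m`, query all its labels, and go on with `T`
and a table of labels that is correct on `T`. -/
def drawAndQuery {ι : Type} {α : Type*} (R : Finset ι) (m : ℕ)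
    (k : Finset ι → (ι → Bool) → LabelAlg ι α) : LabelAlg ι α :=
  .draw R m fun T => queryAll T.toList (fun _ => false) (k T)

/-! ### Classification tasks

`x : Fin n → 𝒳` is the dataset, `H : Set (𝒳 → Bool)` the class of classifiers. -/

variable {𝒳 : Type*} {n : ℕ}

open Classical in
/-- The fraction of the points with index in `T` that `h` misclassifies, the labels being `y`. -/
def err (x : Fin n → 𝒳) (y : Fin n → Bool) (T : Finset (Fin n)) (h : 𝒳 → Bool) : ℝ :=
  ((T.filter fun i => h (x i) ≠ y i).card : ℝ) / (T.card : ℝ)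

open Classical in
/-- The distance of two classifiers: the fraction of points of the dataset where they differ. -/
def hypDist (x : Fin n → 𝒳) (h h' : 𝒳 → Bool) : ℝ :=
  ((Finset.univ.filter fun i => h (x i) ≠ h' (x i)).card : ℝ) / (n : ℝ)

/-- The ball of radius `r` around `h` in `H`. -/
def hypBall (x : Fin n → 𝒳) (H : Set (𝒳 → Bool)) (h : 𝒳 → Bool) (r : ℝ) : Set (𝒳 → Bool) :=
  {h' | h' ∈ H ∧ hypDist x h h' ≤ r}

open Classical in
/-- The disagreement region: the points on which some two classifiers in `V` differ. -/
def disRegion (x : Fin n → 𝒳) (V : Set (𝒳 → Bool)) : Finset (Fin n) :=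
  Finset.univ.filter fun i => ∃ h₁ ∈ V, ∃ h₂ ∈ V, h₁ (x i) ≠ h₂ (x i)

/-- The disagreement coefficient of `H` at `h`. -/
def disCoeffAt (x : Fin n → 𝒳) (H : Set (𝒳 → Bool)) (h : 𝒳 → Bool) : ℝ :=
  ⨆ r : {r : ℝ // 0 < r}, ((disRegion x (hypBall x H h r)).card : ℝ) / ((r : ℝ) * (n : ℝ))

/-- The disagreement coefficient of `H`. -/
def disCoeff (x : Fin n → 𝒳) (H : Set (𝒳 → Bool)) : ℝ :=
  ⨆ h : H, disCoeffAt x H h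

/-- The radius of the smallest ball that contains `V` and has its centre in `V`. -/
def radius (x : Fin n → 𝒳) (V : Set (𝒳 → Bool)) : ℝ :=
  sInf {r : ℝ | ∃ h ∈ V, V ⊆ hypBall x V h r}

/-- `H` shatters the finite set `T`. -/
def Shatters (H : Set (𝒳 → Bool)) (T : Finset 𝒳) : Prop :=
  ∀ f : 𝒳 → Bool, ∃ h ∈ H, ∀ a ∈ T, h a = f a

/-- The VC dimension of `H`: the largest size of a shattered set, or `⊤`. -/
def vcDim (H : Set (𝒳 → Bool)) : ℕ∞ :=
  ⨆ (T : Finset 𝒳) (_ : Shatters H T), (T.card : ℕ∞)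

/-- `h` is a `(1 + ε)`-approximate classifier in `H`: its error on the dataset is at most `1 + ε`
times that of every, hence of an optimal, classifier in `H`. -/
def IsApproxClassifier (x : Fin n → 𝒳) (y : Fin n → Bool) (H : Set (𝒳 → Bool)) (ε : ℝ)
    (h : 𝒳 → Bool) : Prop :=
  h ∈ H ∧ ∀ h' ∈ H, err x y Finset.univ h ≤ (1 + ε) * err x y Finset.univ h'

/-! ### The algorithm -/

/-- The lower error bound of width `w`, from a sample `T` with labels `g`. -/
def LB (x : Fin n → 𝒳) (g : Fin n → Bool) (T : Finset (Fin n)) (w : ℝ) (h : 𝒳 → Bool) : ℝ :=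
  err x g T h - w / 2

/-- The upper error bound of width `w`, from a sample `T` with labels `g`. -/
def UB (x : Fin n → 𝒳) (g : Fin n → Bool) (T : Finset (Fin n)) (w : ℝ) (h : 𝒳 → Bool) : ℝ :=
  err x g T h + w / 2

/-- The classifiers of `V` whose lower bound is at most the least upper bound. -/
def prune (x : Fin n → 𝒳) (V : Set (𝒳 → Bool)) (g : Fin n → Bool) (T : Finset (Fin n)) (w : ℝ) :
    Set (𝒳 → Bool) :=
  {h | h ∈ V ∧ LB x g T w h ≤ sInf (UB x g T w '' V)}

/-- A classifier in `V` with least upper bound. -/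
def argminUB (x : Fin n → 𝒳) (V : Set (𝒳 → Bool)) (g : Fin n → Bool) (T : Finset (Fin n)) (w : ℝ) :
    𝒳 → Bool :=
  Classical.epsilon fun h => h ∈ V ∧ ∀ h' ∈ V, UB x g T w h ≤ UB x g T w h'

lemma one_le_mul_radius (x : Fin n → 𝒳) (V : Set (𝒳 → Bool)) (hV : (disRegion x V).Nonempty) :
    1 ≤ (n : ℝ) * radius x V := by
  classical
  obtain ⟨i, hi⟩ := hV
  obtain ⟨-, h₁, m₁, h₂, m₂, hne⟩ := Finset.mem_filter.1 hi
  have hn : (0 : ℝ) < n := by exact_mod_cast i.pos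
  have key : 1 / (n : ℝ) ≤ radius x V := by
    refine le_csInf ⟨1, h₁, m₁, fun h hh => ⟨hh, ?_⟩⟩ ?_
    · refine (div_le_one hn).2 ?_
      exact_mod_cast (Finset.card_le_univ _).trans (by simp)
    · rintro r ⟨h, -, hb⟩
      obtain ⟨k, hk, hd⟩ : ∃ k ∈ V, h (x i) ≠ k (x i) := by
        by_cases hc : h (x i) = h₁ (x i)
        · exact ⟨h₂, m₂, hc ▸ hne⟩
        · exact ⟨h₁, m₁, hc⟩
      refine le_trans ?_ (hb hk).2
      unfold hypDist
      gcongr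
      exact_mod_cast Finset.card_pos.2 ⟨i, by simpa using hd⟩
  rw [mul_comm]
  exact (div_le_iff₀ hn).1 key

open Classical in
/-- A bound for the number of remaining rounds; used only to see that the loop terminates. -/
def loopMeasure (x : Fin n → 𝒳) (V : Set (𝒳 → Bool)) (r : ℝ) : ℕ :=
  if (disRegion x V).Nonempty then ⌊(n : ℝ) * r⌋₊ + 1 else 0

lemma loopMeasure_lt (x : Fin n → 𝒳) (V V' : Set (𝒳 → Bool)) (r : ℝ)
    (hV : (disRegion x V).Nonempty) (hr : ¬ r / 2 < radius x V') :
    loopMeasure x V' (radius x V') < loopMeasure x V r := by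
  unfold loopMeasure
  rw [if_pos hV]
  split_ifs with hV'
  · have h1 := one_le_mul_radius x V' hV'
    have h2 : (n : ℝ) * radius x V' + 1 ≤ n * r := by
      have : (n : ℝ) * radius x V' ≤ n * (r / 2) :=
        mul_le_mul_of_nonneg_left (not_lt.1 hr) (Nat.cast_nonneg n)
      linarith
    have h3 := Nat.floor_mono h2
    rw [Nat.floor_add_one (by linarith)] at h3
    omega
  · omega

open Classical in
/-- The loop of the algorithm, with current candidates `V` and progress measure `r`. The sample
sizes are `m₁` in a round and `m₂` in the final estimation; the widths of the error bounds are `w₁`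
and `w₂`. Classifiers that agree on the dataset count as equal, so the loop condition, that more
than one candidate is left, says that the disagreement region is not empty. -/
def loop (x : Fin n → 𝒳) (m₁ m₂ : ℕ) (w₁ w₂ : ℝ) (V : Set (𝒳 → Bool)) (r : ℝ) :
    LabelAlg (Fin n) (𝒳 → Bool) :=
  if hV : (disRegion x V).Nonempty then
    drawAndQuery (disRegion x V) m₁ fun T g =>
      if hr : r / 2 < radius x (prune x V g T w₁) then
        drawAndQuery (disRegion x V) m₂ fun T' g' => .ret (argminUB x V g' T' w₂)
      else
        loop x m₁ m₂ w₁ w₂ (prune x V g T w₁) (radius x (prune x V g T w₁))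
  else
    .ret (Classical.epsilon fun h => h ∈ V)
termination_by loopMeasure x V r
decreasing_by exact loopMeasure_lt x V _ r hV hr

/-- The algorithm for general binary classification with accuracy `ε`, confidence `δ` and constants
`c₁, b₁, c₂, b₂`. Here `θ` is the disagreement coefficient, `d` the VC dimension and
`δ' = δ / (2 log₂ (2n))`. -/
def generalAlgorithm (c₁ b₁ c₂ b₂ : ℝ) (x : Fin n → 𝒳) (H : Set (𝒳 → Bool)) (ε δ : ℝ) :
    LabelAlg (Fin n) (𝒳 → Bool) :=
  let θ : ℝ := disCoeff x H
  let d : ℝ := ((vcDim H).toNat : ℝ)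
  let δ' : ℝ := δ / (2 * Real.logb 2 (2 * n))
  loop x
    ⌈c₁ * θ ^ 2 * (d * Real.log θ + Real.log (1 / δ')) + b₁⌉₊
    ⌈c₂ * θ ^ 2 / ε ^ 2 * (d * Real.log (θ / ε) + Real.log (1 / δ)) + b₂⌉₊
    (1 / (16 * θ)) (ε / (16 * θ)) H 1

end ActiveLearning

end

namespace ActiveLearning

open Finset

variable {ι 𝒳 : Type*} {n : ℕ}

/-! Fix a classifier `k₀` with least error on the dataset. A sample is good when every candidate's
error on it is within `1/(32θ)` of its error on the disagreement region `D`. Candidates agree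
outside `D`, so `k₀` is also best on `D`. On a good sample it survives pruning, and each survivor
has error on `D` at most `2w₁` above `ν`, the error of `k₀` there. Two candidates that differ at a
point cannot both be right, so survivors lie within `|D|(2ν + 2w₁)/n` of `k₀`. Since `|D| ≤ θrn`, a
radius that fails to halve forces `|D|ν > 3rn/16`: the optimum itself makes many mistakes. The final
estimation has excess at most `|D|ε/(16θ) ≤ εrn/16` mistakes, which is then at most `ε` times the
optimum (`isApprox_argminUB`). If the radius always halves, `nr ≥ 1` while candidates disagree, so
at most `log₂ n + 1` rounds occur. A union bound gives `loop_failure_le`, the same potential gives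
`loop_queries_le`.

The probabilistic core is `uniformSubset_deviation_le`. For sampling without replacement,
`card_deviation_le` compares the sample with a ghost sample and exchanges paired points, and
Sauer–Shelah counts the traces.

One case escapes this argument: when `θ/ε` is near one, `V_H ln(θ/ε)` may vanish and the sample size
no longer pays for the VC dimension. But then `θ` is near one, and `exists_two_centres` shows that
all candidates cluster around two classifiers. Four fixed sets control all deviations, whatever the
VC dimension. -/

/-! ### Uniform deviations for sampling without replacement -/

/-- Symmetrization: the exponential moment of a sum of differences over disjoint pairs, under a
random permutation whose weight is invariant under exchanging the points of each pair. -/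
lemma sum_perm_exp_le [Fintype ι] [DecidableEq ι] (b : ι → ℝ) (hb : ∀ i j, |b i - b j| ≤ 1) (t : ℝ)
    (S : Finset ι) (e : ι → ι) (he : Set.InjOn e S) (hS : ∀ i ∈ S, e i ∉ S)
    (ψ : Equiv.Perm ι → ℝ) (h0 : ∀ g, 0 ≤ ψ g)
    (hψ : ∀ i ∈ S, ∀ g, ψ (g * Equiv.swap i (e i)) = ψ g) :
    ∑ g, ψ g * ∏ i ∈ S, Real.exp (t * (b (g i) - b (g (e i)))) ≤
      Real.exp (t ^ 2 / 2) ^ S.card * ∑ g, ψ g := by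
  induction S using Finset.induction_on with
  | empty => simp
  | insert j S hj ih =>
    have ih' := ih (he.mono (by simp)) (fun i hi h => hS i (mem_insert_of_mem hi)
      (mem_insert_of_mem h)) (fun i hi => hψ i (mem_insert_of_mem hi))
    set E : Equiv.Perm ι → ℝ := fun g => ψ g * ∏ i ∈ S, Real.exp (t * (b (g i) - b (g (e i))))
      with hE
    set s := Equiv.swap j (e j) with hs
    have hE0 : ∀ g, 0 ≤ E g := fun g =>
      mul_nonneg (h0 g) (prod_nonneg fun _ _ => (Real.exp_pos _).le)
    have hEs : ∀ g, E (g * s) = E g := by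
      intro g
      simp only [hE]
      rw [hψ j (mem_insert_self _ _)]
      congr 1
      refine prod_congr rfl fun i hi => ?_
      have h1 : i ≠ j := fun h => hj (h ▸ hi)
      have h2 : i ≠ e j := fun h => hS j (mem_insert_self _ _) (h ▸ mem_insert_of_mem hi)
      have h3 : e i ≠ j := fun h => hS i (mem_insert_of_mem hi) (h ▸ mem_insert_self _ _)
      have h4 : e i ≠ e j := fun h => h1 (he (by simp [hi]) (by simp) h)
      simp only [Equiv.Perm.mul_apply, hs, Equiv.swap_apply_of_ne_of_ne h1 h2,
        Equiv.swap_apply_of_ne_of_ne h3 h4]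
    set D : Equiv.Perm ι → ℝ := fun g => b (g j) - b (g (e j)) with hD
    have hDs : ∀ g, D (g * s) = -D g := by
      intro g
      simp [hD, hs]
    -- Reindexing by the swap keeps `E` and flips the sign of `D`; averaging both forms turns the
    -- exponential into a hyperbolic cosine.
    have hsum : ∑ g, E g * Real.exp (t * D g) = ∑ g, E g * Real.exp (-(t * D g)) := by
      rw [← Equiv.sum_comp (Equiv.mulRight s)]
      simp [hEs, hDs]
    have hcosh : ∑ g, E g * Real.exp (t * D g) = ∑ g, E g * Real.cosh (t * D g) := by
      have : ∑ g, E g * Real.cosh (t * D g) =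
          (∑ g, E g * Real.exp (t * D g) + ∑ g, E g * Real.exp (-(t * D g))) / 2 := by
        rw [← sum_add_distrib, sum_div]
        refine sum_congr rfl fun g _ => ?_
        rw [Real.cosh_eq]; ring
      rw [this, ← hsum]; ring
    have hle : ∀ g, Real.cosh (t * D g) ≤ Real.exp (t ^ 2 / 2) := by
      intro g
      refine (Real.cosh_le_exp_half_sq _).trans (Real.exp_le_exp.2 ?_)
      have h1 : D g ^ 2 ≤ 1 := by
        rw [← sq_abs]
        exact pow_le_one₀ (abs_nonneg _) (hb _ _)
      rw [mul_pow]
      nlinarith [sq_nonneg t]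
    calc ∑ g, ψ g * ∏ i ∈ insert j S, Real.exp (t * (b (g i) - b (g (e i))))
        = ∑ g, E g * Real.exp (t * D g) := by
          refine sum_congr rfl fun g _ => ?_
          rw [prod_insert hj]; simp only [hE, hD]; ring
      _ = ∑ g, E g * Real.cosh (t * D g) := hcosh
      _ ≤ ∑ g, E g * Real.exp (t ^ 2 / 2) :=
          sum_le_sum fun g _ => mul_le_mul_of_nonneg_left (hle g) (hE0 g)
      _ = Real.exp (t ^ 2 / 2) * ∑ g, E g := by rw [← sum_mul, mul_comm]
      _ ≤ Real.exp (t ^ 2 / 2) * (Real.exp (t ^ 2 / 2) ^ S.card * ∑ g, ψ g) :=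
          mul_le_mul_of_nonneg_left ih' (Real.exp_pos _).le
      _ = _ := by rw [card_insert_of_notMem hj]; ring

/-- The mean of `#(A ∩ T)` over the `m`-subsets `T` of `R`. -/
lemma sum_card_inter_powersetCard [DecidableEq ι] (R A : Finset ι) (m : ℕ) :
    R.card * ∑ T ∈ R.powersetCard m, (A ∩ T).card =
      m * (A ∩ R).card * (R.powersetCard m).card := by
  have hconst : ∀ i ∈ R, ∀ j ∈ R, ((R.powersetCard m).filter (i ∈ ·)).card =
      ((R.powersetCard m).filter (j ∈ ·)).card := by
    intro i hi j hj
    have hR : ∀ k, Equiv.swap i j k ∈ R ↔ k ∈ R := by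
      intro k
      by_cases h1 : k = i
      · subst h1; simp [hi, hj]
      · by_cases h2 : k = j
        · subst h2; simp [hi, hj]
        · rw [Equiv.swap_apply_of_ne_of_ne h1 h2]
    refine card_bij' (fun T _ => T.map (Equiv.swap i j).toEmbedding)
      (fun T _ => T.map (Equiv.swap i j).toEmbedding) ?_ ?_ ?_ ?_
    · intro T hT
      simp only [mem_filter, mem_powersetCard] at hT ⊢
      refine ⟨⟨?_, by simp [hT.1.2]⟩, ?_⟩
      · intro k hk
        simp only [mem_map_equiv, Equiv.symm_swap] at hk
        exact (hR k).1 (hT.1.1 hk)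
      · simp [mem_map_equiv, hT.2]
    · intro T hT
      simp only [mem_filter, mem_powersetCard] at hT ⊢
      refine ⟨⟨?_, by simp [hT.1.2]⟩, ?_⟩
      · intro k hk
        simp only [mem_map_equiv, Equiv.symm_swap] at hk
        exact (hR k).1 (hT.1.1 hk)
      · simp [mem_map_equiv, hT.2]
    · intro T _
      ext k
      simp [mem_map_equiv]
    · intro T _
      ext k
      simp [mem_map_equiv]
  have hcount : ∀ B : Finset ι, ∑ T ∈ R.powersetCard m, (B ∩ T).card =
      ∑ i ∈ B, ((R.powersetCard m).filter (i ∈ ·)).card := by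
    intro B
    simp only [card_eq_sum_ones, sum_filter, ← filter_mem_eq_inter]
    rw [sum_comm]
  rcases R.eq_empty_or_nonempty with rfl | ⟨i₀, hi₀⟩
  · simp
  set c := ((R.powersetCard m).filter (i₀ ∈ ·)).card
  have h1 : ∀ B ⊆ R, ∑ T ∈ R.powersetCard m, (B ∩ T).card = B.card * c := by
    intro B hB
    rw [hcount, sum_congr rfl fun i hi => hconst i (hB hi) i₀ hi₀, sum_const, smul_eq_mul]
  have h2 : R.card * c = m * (R.powersetCard m).card := by
    rw [← h1 R subset_rfl, sum_congr rfl (g := fun _ => m), sum_const, smul_eq_mul, mul_comm]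
    intro T hT
    rw [mem_powersetCard] at hT
    rw [inter_eq_right.2 hT.1, hT.2]
  have h3 : ∑ T ∈ R.powersetCard m, (A ∩ T).card = (A ∩ R).card * c := by
    rw [← h1 _ inter_subset_right]
    refine sum_congr rfl fun T hT => ?_
    rw [inter_assoc, inter_eq_right.2 (mem_powersetCard.1 hT).1]
  rw [h3]
  calc _ = (A ∩ R).card * (R.card * c) := by ring
    _ = _ := by rw [h2]; ring

/-- Traces of a family on a set. -/
def traces [DecidableEq ι] (𝒜 : Finset (Finset ι)) (U : Finset ι) : Finset (Finset ι) :=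
  𝒜.image (· ∩ U)

/-- The samples may overlap. Common points cancel in the exponent, and `T \ T'` is matched with `T'
\ T`. The indicator depends on the permutation only through the images of `R` and `T ∪ T'`, which
exchanging matched points preserves, so it can serve as the weight `ψ`. -/
lemma sum_perm_trace_le [Fintype ι] [DecidableEq ι] (𝒜 : Finset (Finset ι)) (R T T' B : Finset ι)
    (m : ℕ) (hT : T ∈ R.powersetCard m) (hT' : T' ∈ R.powersetCard m) (t : ℝ) :
    ∑ g : Equiv.Perm ι, (if R.map g.toEmbedding = R ∧
        B ∈ traces 𝒜 ((T ∪ T').map g.toEmbedding) then (1 : ℝ) else 0) *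
        Real.exp (t * ((B ∩ T.map g.toEmbedding).card - (B ∩ T'.map g.toEmbedding).card)) ≤
      Real.exp (m * (t ^ 2 / 2)) * ∑ g : Equiv.Perm ι, (if R.map g.toEmbedding = R ∧
        B ∈ traces 𝒜 ((T ∪ T').map g.toEmbedding) then (1 : ℝ) else 0) := by
  rw [mem_powersetCard] at hT hT'
  obtain ⟨e, heq⟩ : ∃ e : ι → ι, Set.BijOn e (T \ T' : Finset ι) (T' \ T : Finset ι) := by
    have hc : (T \ T').card = (T' \ T).card := by
      have h1 := card_sdiff_add_card_inter T T'
      have h2 := card_sdiff_add_card_inter T' T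
      rw [inter_comm] at h2
      omega
    let E := equivOfCardEq hc
    refine ⟨fun i => if h : i ∈ T \ T' then (E ⟨i, h⟩ : ι) else i, fun i hi => ?_, ?_, ?_⟩
    · rw [mem_coe] at hi
      simp only [hi, dif_pos]
      exact (E ⟨i, hi⟩).2
    · intro i hi j hj hij
      rw [mem_coe] at hi hj
      simp only [hi, hj, dif_pos] at hij
      simpa using E.injective (Subtype.ext hij)
    · intro j hj
      refine ⟨E.symm ⟨j, hj⟩, (E.symm ⟨j, hj⟩).2, ?_⟩
      have h := (E.symm ⟨j, hj⟩).2
      simp only [h, dif_pos, Subtype.coe_eta, Equiv.apply_symm_apply]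
  set b : ι → ℝ := fun i => if i ∈ B then 1 else 0 with hb
  have hmapinv : ∀ (g : Equiv.Perm ι) (i j : ι) (W : Finset ι), i ∈ W → j ∈ W →
      W.map (g * Equiv.swap i j).toEmbedding = W.map g.toEmbedding := by
    intro g i j W hi hj
    have : W.map (Equiv.swap i j).toEmbedding = W := by
      ext k
      simp only [mem_map_equiv, Equiv.symm_swap]
      by_cases h1 : k = i
      · subst h1; simp [hi, hj]
      · by_cases h2 : k = j
        · subst h2; simp [hi, hj]
        · rw [Equiv.swap_apply_of_ne_of_ne h1 h2]
    conv_rhs => rw [← this]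
    rw [map_map]
    rfl
  have key := sum_perm_exp_le b (by intro i j; simp only [hb]; split_ifs <;> norm_num) t (T \ T') e
    heq.injOn (fun i hi h => (mem_sdiff.1 (heq.mapsTo hi)).2 (mem_sdiff.1 h).1)
    (fun g => if R.map g.toEmbedding = R ∧
        B ∈ traces 𝒜 ((T ∪ T').map g.toEmbedding) then (1 : ℝ) else 0)
    (by intro g; split_ifs <;> norm_num)
    (by
      intro i hi g
      have h1 : i ∈ T := (mem_sdiff.1 hi).1
      have h2 : e i ∈ T' := (mem_sdiff.1 (heq.mapsTo hi)).1
      rw [hmapinv g i (e i) R (hT.1 h1) (hT'.1 h2),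
        hmapinv g i (e i) _ (mem_union_left _ h1) (mem_union_right _ h2)])
  have hcard : ∀ (g : Equiv.Perm ι) (W : Finset ι),
      ((B ∩ W.map g.toEmbedding).card : ℝ) = ∑ i ∈ W, b (g i) := by
    intro g W
    rw [inter_comm, ← filter_mem_eq_inter, filter_map, card_map]
    simp [hb]
  have hexp : ∀ g : Equiv.Perm ι,
      Real.exp (t * ((B ∩ T.map g.toEmbedding).card - (B ∩ T'.map g.toEmbedding).card)) =
      ∏ i ∈ T \ T', Real.exp (t * (b (g i) - b (g (e i)))) := by
    intro g
    rw [← Real.exp_sum, ← mul_sum, sum_sub_distrib, hcard, hcard]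
    have h1 : ∑ i ∈ T \ T', b (g (e i)) = ∑ i ∈ T' \ T, b (g i) :=
      sum_nbij e (fun i hi => heq.mapsTo hi) heq.injOn heq.surjOn (fun _ _ => rfl)
    have h2 := sum_sdiff_sub_sum_sdiff (s₁ := T') (s₂ := T) (f := fun i => b (g i))
    rw [h1]
    congr 2
    linarith
  refine (sum_congr rfl fun g _ => by rw [hexp g]).trans_le (key.trans ?_)
  refine mul_le_mul_of_nonneg_right ?_ (sum_nonneg fun g _ => by split_ifs <;> norm_num)
  rw [← Real.exp_nat_mul]
  refine Real.exp_le_exp.2 (mul_le_mul_of_nonneg_right ?_ (by positivity))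
  exact_mod_cast (card_le_card sdiff_subset).trans hT.2.le

lemma sum_powersetCard_map [Fintype ι] [DecidableEq ι] (R : Finset ι) (m : ℕ) (g : Equiv.Perm ι)
    (hg : R.map g.toEmbedding = R) (F : Finset ι → ℝ) :
    ∑ T ∈ R.powersetCard m, F (T.map g.toEmbedding) = ∑ T ∈ R.powersetCard m, F T := by
  conv_rhs => rw [← hg, powersetCard_map, sum_map]
  rfl

/-- Relabelling by a permutation that preserves `R` does not change the double sum, so it may be
averaged over all of them. For a fixed pair of samples the random signs then come from the
permutation, and the traces cost a factor `N`. -/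
lemma sum_sum_traces_exp_le [Fintype ι] [DecidableEq ι] (𝒜 : Finset (Finset ι)) (R : Finset ι)
    (m : ℕ) (N : ℝ) (hN : ∀ U, U.card ≤ 2 * m → ((traces 𝒜 U).card : ℝ) ≤ N) (t : ℝ) :
    ∑ T ∈ R.powersetCard m, ∑ T' ∈ R.powersetCard m, ∑ B ∈ traces 𝒜 (T ∪ T'),
      Real.exp (t * ((B ∩ T).card - (B ∩ T').card)) ≤
    ((R.powersetCard m).card : ℝ) ^ 2 * (N * Real.exp (m * (t ^ 2 / 2))) := by
  set P : Finset (Equiv.Perm ι) := univ.filter fun g => R.map g.toEmbedding = R with hP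
  have hP1 : (0 : ℝ) < P.card := by
    have : (1 : Equiv.Perm ι) ∈ P := by
      simp only [hP, mem_filter, mem_univ, true_and]
      exact map_refl
    exact_mod_cast card_pos.2 ⟨_, this⟩
  set F : Finset ι → Finset ι → ℝ := fun T T' => ∑ B ∈ traces 𝒜 (T ∪ T'),
      Real.exp (t * ((B ∩ T).card - (B ∩ T').card)) with hF
  have hinv : ∀ g ∈ P, ∑ T ∈ R.powersetCard m, ∑ T' ∈ R.powersetCard m,
      F (T.map g.toEmbedding) (T'.map g.toEmbedding) =
      ∑ T ∈ R.powersetCard m, ∑ T' ∈ R.powersetCard m, F T T' := by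
    intro g hg
    have hg' : R.map g.toEmbedding = R := (mem_filter.1 hg).2
    rw [← sum_powersetCard_map R m g hg' (fun T => ∑ T' ∈ R.powersetCard m, F T T')]
    refine sum_congr rfl fun T _ => ?_
    rw [sum_powersetCard_map R m g hg' (fun T' => F (T.map g.toEmbedding) T')]
  have hpair : ∀ T ∈ R.powersetCard m, ∀ T' ∈ R.powersetCard m,
      ∑ g ∈ P, F (T.map g.toEmbedding) (T'.map g.toEmbedding) ≤
        P.card * (N * Real.exp (m * (t ^ 2 / 2))) := by
    intro T hT T' hT'
    have hU : (T ∪ T').card ≤ 2 * m := by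
      rw [mem_powersetCard] at hT hT'
      have := card_union_le T T'
      omega
    have e1 : ∑ g ∈ P, F (T.map g.toEmbedding) (T'.map g.toEmbedding) =
        ∑ B : Finset ι, ∑ g : Equiv.Perm ι, (if R.map g.toEmbedding = R ∧
        B ∈ traces 𝒜 ((T ∪ T').map g.toEmbedding) then (1 : ℝ) else 0) *
        Real.exp (t * ((B ∩ T.map g.toEmbedding).card - (B ∩ T'.map g.toEmbedding).card)) := by
      rw [sum_comm, hP, sum_filter]
      refine sum_congr rfl fun g _ => ?_
      by_cases h : R.map g.toEmbedding = R
      · simp only [h, true_and, if_true, hF, ite_mul, one_mul, zero_mul]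
        rw [← sum_filter, map_union]
        congr 1
        ext B; simp
      · simp [h]
    have e2 : ∑ B : Finset ι, ∑ g : Equiv.Perm ι, (if R.map g.toEmbedding = R ∧
        B ∈ traces 𝒜 ((T ∪ T').map g.toEmbedding) then (1 : ℝ) else 0) =
        ∑ g ∈ P, ((traces 𝒜 ((T ∪ T').map g.toEmbedding)).card : ℝ) := by
      rw [sum_comm, hP, sum_filter]
      refine sum_congr rfl fun g _ => ?_
      by_cases h : R.map g.toEmbedding = R
      · simp [h]
      · simp [h]
    rw [e1]
    refine (sum_le_sum fun B _ => sum_perm_trace_le 𝒜 R T T' B m hT hT' t).trans ?_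
    rw [← mul_sum, e2]
    have e3 : ∑ g ∈ P, ((traces 𝒜 ((T ∪ T').map g.toEmbedding)).card : ℝ) ≤ P.card * N := by
      refine (sum_le_card_nsmul _ _ N fun g _ => hN _ (by rwa [card_map])).trans ?_
      simp
    nlinarith [mul_le_mul_of_nonneg_left e3 (Real.exp_pos (m * (t ^ 2 / 2))).le]
  have htot : (P.card : ℝ) * ∑ T ∈ R.powersetCard m, ∑ T' ∈ R.powersetCard m, F T T' ≤
      P.card * (((R.powersetCard m).card : ℝ) ^ 2 * (N * Real.exp (m * (t ^ 2 / 2)))) := by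
    calc _ = ∑ g ∈ P, ∑ T ∈ R.powersetCard m, ∑ T' ∈ R.powersetCard m,
          F (T.map g.toEmbedding) (T'.map g.toEmbedding) := by
            rw [sum_congr rfl hinv, sum_const, nsmul_eq_mul]
      _ = ∑ T ∈ R.powersetCard m, ∑ T' ∈ R.powersetCard m, ∑ g ∈ P,
          F (T.map g.toEmbedding) (T'.map g.toEmbedding) := by
            rw [sum_comm]
            exact sum_congr rfl fun T _ => sum_comm
      _ ≤ ∑ T ∈ R.powersetCard m, ∑ T' ∈ R.powersetCard m,
          (P.card * (N * Real.exp (m * (t ^ 2 / 2)))) :=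
            sum_le_sum fun T hT => sum_le_sum fun T' hT' => hpair T hT T' hT'
      _ = _ := by simp only [sum_const, nsmul_eq_mul]; ring
  exact le_of_mul_le_mul_left htot hP1

/-- Uniform deviation bound for sampling without replacement: the number of `m`-subsets `T` of `R`
on which the frequency of some member of the family is off by more than `a`. -/
theorem card_deviation_le [Fintype ι] [DecidableEq ι] (𝒜 : Finset (Finset ι)) (R : Finset ι)
    (m : ℕ) (hm : 0 < m) (hmR : m ≤ R.card) (N : ℝ)
    (hN : ∀ U, U.card ≤ 2 * m → ((traces 𝒜 U).card : ℝ) ≤ N) (a : ℝ) (ha : 0 < a) :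
    (((R.powersetCard m).filter fun T =>
      ∃ A ∈ 𝒜, a < |((A ∩ T).card : ℝ) / m - ((A ∩ R).card : ℝ) / R.card|).card : ℝ) ≤
      2 * N * Real.exp (-(a ^ 2 * m / 2)) * (R.powersetCard m).card := by
  set K : ℝ := ((R.powersetCard m).card : ℝ) with hK
  have hm' : (0 : ℝ) < m := by exact_mod_cast hm
  have hR : (0 : ℝ) < R.card := by exact_mod_cast hm.trans_le hmR
  have hK0 : 0 < K := by
    rw [hK]; exact_mod_cast card_pos.2 (powersetCard_nonempty.2 hmR)
  set F : ℝ → Finset ι → Finset ι → ℝ := fun t T T' => ∑ B ∈ traces 𝒜 (T ∪ T'),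
      Real.exp (t * ((B ∩ T).card - (B ∩ T').card)) with hF
  -- The frequency in `R` is the mean frequency over ghost samples `T'`, so by convexity the ghost
  -- sample can be averaged outside the exponential.
  have hmean : ∀ A : Finset ι, ((A ∩ R).card : ℝ) / R.card =
      ∑ T' ∈ R.powersetCard m, K⁻¹ * (((A ∩ T').card : ℝ) / m) := by
    intro A
    have h := sum_card_inter_powersetCard R A m
    have h' : (R.card : ℝ) * ∑ T ∈ R.powersetCard m, ((A ∩ T).card : ℝ) =
      m * (A ∩ R).card * K := by rw [hK]; exact_mod_cast h
    rw [← mul_sum, ← sum_div]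
    field_simp
    linarith
  have hdev : ∀ (A T : Finset ι), ((A ∩ T).card : ℝ) / m - ((A ∩ R).card : ℝ) / R.card =
      ∑ T' ∈ R.powersetCard m, K⁻¹ * (((A ∩ T).card - (A ∩ T').card : ℝ) / m) := by
    intro A T
    rw [hmean]
    have : ((A ∩ T).card : ℝ) / m = ∑ T' ∈ R.powersetCard m, K⁻¹ * (((A ∩ T).card : ℝ) / m) := by
      rw [sum_const, nsmul_eq_mul, ← hK]
      field_simp
    conv_lhs => rw [this]
    rw [← sum_sub_distrib]
    exact sum_congr rfl fun _ _ => by ring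
  have hjensen : ∀ (t : ℝ) (A T : Finset ι), A ∈ 𝒜 →
      Real.exp (t * m * (((A ∩ T).card : ℝ) / m - ((A ∩ R).card : ℝ) / R.card)) ≤
      K⁻¹ * ∑ T' ∈ R.powersetCard m, F t T T' := by
    intro t A T hA
    have h1 : t * m * (((A ∩ T).card : ℝ) / m - ((A ∩ R).card : ℝ) / R.card) =
        ∑ T' ∈ R.powersetCard m, K⁻¹ • (t * ((A ∩ T).card - (A ∩ T').card : ℝ)) := by
      rw [hdev, mul_sum]
      refine sum_congr rfl fun T' _ => ?_
      rw [smul_eq_mul]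
      field_simp
    rw [h1]
    refine (convexOn_exp.map_sum_le (fun _ _ => (inv_pos.2 hK0).le) ?_ (fun _ _ => trivial)).trans ?_
    · rw [sum_const, nsmul_eq_mul, ← hK]
      exact mul_inv_cancel₀ hK0.ne'
    · rw [mul_sum]
      refine sum_le_sum fun T' _ => ?_
      rw [smul_eq_mul]
      refine mul_le_mul_of_nonneg_left ?_ (inv_pos.2 hK0).le
      have h2 : A ∩ (T ∪ T') ∈ traces 𝒜 (T ∪ T') := mem_image_of_mem _ hA
      have h3 : A ∩ T = A ∩ (T ∪ T') ∩ T := by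
        rw [inter_assoc, inter_eq_right.2 subset_union_left]
      have h4 : A ∩ T' = A ∩ (T ∪ T') ∩ T' := by
        rw [inter_assoc, inter_eq_right.2 subset_union_right]
      rw [h3, h4]
      exact single_le_sum (f := fun B : Finset ι =>
        Real.exp (t * ((B ∩ T).card - (B ∩ T').card))) (fun _ _ => (Real.exp_pos _).le) h2
  set bad := (R.powersetCard m).filter fun T =>
      ∃ A ∈ 𝒜, a < |((A ∩ T).card : ℝ) / m - ((A ∩ R).card : ℝ) / R.card| with hbad
  -- Chernoff bound at `t = a`, which minimizes `m * t ^ 2 / 2 - t * m * a`; the parameters `a` and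
  -- `-a` cover the two signs of the deviation.
  have hmain : (bad.card : ℝ) * Real.exp (a * m * a) ≤
      2 * (K * (N * Real.exp (m * (a ^ 2 / 2)))) := by
    calc (bad.card : ℝ) * Real.exp (a * m * a) = ∑ T ∈ bad, Real.exp (a * m * a) := by
          rw [sum_const, nsmul_eq_mul]
      _ ≤ ∑ T ∈ bad, (K⁻¹ * ∑ T' ∈ R.powersetCard m, F a T T' +
            K⁻¹ * ∑ T' ∈ R.powersetCard m, F (-a) T T') := by
          refine sum_le_sum fun T hT => ?_
          obtain ⟨A, hA, hlt⟩ := (mem_filter.1 hT).2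
          have h1 := hjensen a A T hA
          have h2 := hjensen (-a) A T hA
          set X := ((A ∩ T).card : ℝ) / m - ((A ∩ R).card : ℝ) / R.card
          refine le_trans ?_ (add_le_add h1 h2)
          rcases lt_abs.1 hlt with h | h
          · have : Real.exp (a * m * a) ≤ Real.exp (a * m * X) :=
              Real.exp_le_exp.2 (mul_le_mul_of_nonneg_left h.le (by positivity))
            linarith [Real.exp_pos (-a * m * X)]
          · have : Real.exp (a * m * a) ≤ Real.exp (-a * m * X) := by
              refine Real.exp_le_exp.2 ?_
              have := mul_le_mul_of_nonneg_left h.le (show 0 ≤ a * m by positivity)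
              linarith
            linarith [Real.exp_pos (a * m * X)]
      _ ≤ ∑ T ∈ R.powersetCard m, (K⁻¹ * ∑ T' ∈ R.powersetCard m, F a T T' +
            K⁻¹ * ∑ T' ∈ R.powersetCard m, F (-a) T T') := by
          refine sum_le_sum_of_subset_of_nonneg (filter_subset _ _) fun T _ _ => ?_
          have h : ∀ t, 0 ≤ K⁻¹ * ∑ T' ∈ R.powersetCard m, F t T T' := fun t =>
            mul_nonneg (inv_pos.2 hK0).le
              (sum_nonneg fun _ _ => sum_nonneg fun _ _ => (Real.exp_pos _).le)
          exact add_nonneg (h _) (h _)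
      _ = K⁻¹ * ∑ T ∈ R.powersetCard m, ∑ T' ∈ R.powersetCard m, F a T T' +
            K⁻¹ * ∑ T ∈ R.powersetCard m, ∑ T' ∈ R.powersetCard m, F (-a) T T' := by
          rw [sum_add_distrib, mul_sum, mul_sum]
      _ ≤ K⁻¹ * (K ^ 2 * (N * Real.exp (m * (a ^ 2 / 2)))) +
            K⁻¹ * (K ^ 2 * (N * Real.exp (m * ((-a) ^ 2 / 2)))) := by
          have h := sum_sum_traces_exp_le 𝒜 R m N hN
          exact add_le_add (mul_le_mul_of_nonneg_left (h a) (inv_pos.2 hK0).le)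
            (mul_le_mul_of_nonneg_left (h (-a)) (inv_pos.2 hK0).le)
      _ = _ := by
          rw [neg_sq]
          field_simp
          ring
  have h1 : (bad.card : ℝ) = bad.card * Real.exp (a * m * a) * Real.exp (-(a * m * a)) := by
    rw [mul_assoc, ← Real.exp_add]; simp
  rw [h1]
  refine (mul_le_mul_of_nonneg_right hmain (Real.exp_pos _).le).trans_eq ?_
  have h2 : Real.exp (-(a ^ 2 * m / 2)) = Real.exp (m * (a ^ 2 / 2)) * Real.exp (-(a * m * a)) := by
    rw [← Real.exp_add]; congr 1; ring
  rw [h2]; ring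

/-- A Sauer–Shelah bound in exponential form. -/
lemma card_traces_le [Fintype ι] [DecidableEq ι] (𝒜 : Finset (Finset ι)) (d : ℕ)
    (hd : ∀ s, 𝒜.Shatters s → s.card ≤ d) (U : Finset ι) (z : ℝ) (hz : 0 < z) (hz1 : z ≤ 1) :
    ((traces 𝒜 U).card : ℝ) ≤ (z ^ d)⁻¹ * (1 + z) ^ U.card := by
  have hsub : (traces 𝒜 U).shatterer ⊆ U.powerset.filter fun s => s.card ≤ d := by
    intro s hs
    rw [mem_shatterer] at hs
    have hsU : s ⊆ U := by
      obtain ⟨B, hB, hsB⟩ := hs.exists_superset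
      obtain ⟨A, -, rfl⟩ := mem_image.1 hB
      exact hsB.trans inter_subset_right
    refine mem_filter.2 ⟨mem_powerset.2 hsU, hd s fun u hu => ?_⟩
    obtain ⟨B, hB, hsB⟩ := hs hu
    obtain ⟨A, hA, rfl⟩ := mem_image.1 hB
    refine ⟨A, hA, ?_⟩
    rw [← hsB, inter_comm A U, ← inter_assoc, inter_eq_left.2 hsU]
  calc ((traces 𝒜 U).card : ℝ) ≤ (traces 𝒜 U).shatterer.card := by
        exact_mod_cast card_le_card_shatterer _
    _ ≤ (U.powerset.filter fun s => s.card ≤ d).card := by exact_mod_cast card_le_card hsub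
    _ = ∑ s ∈ U.powerset.filter fun s => s.card ≤ d, (1 : ℝ) := by simp
    -- Since `z ≤ 1`, each set of size at most `d` has weight at least one, and the weighted sum
    -- over all subsets is a binomial expansion.
    _ ≤ ∑ s ∈ U.powerset.filter fun s => s.card ≤ d, (z ^ d)⁻¹ * z ^ s.card := by
        refine sum_le_sum fun s hs => ?_
        rw [inv_mul_eq_div, le_div_iff₀ (by positivity), one_mul]
        exact pow_le_pow_of_le_one hz.le hz1 (mem_filter.1 hs).2
    _ ≤ ∑ s ∈ U.powerset, (z ^ d)⁻¹ * z ^ s.card :=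
        sum_le_sum_of_subset_of_nonneg (filter_subset _ _) fun _ _ _ => by positivity
    _ = _ := by
        rw [← mul_sum]
        congr 1
        have := Finset.sum_pow_mul_eq_add_pow z 1 U
        simp only [one_pow, mul_one] at this
        rw [this, add_comm]

/-! ### Error sets, disagreement coefficient and VC dimension -/

/-- The points on which two classifiers differ. -/
def diffSet (x : Fin n → 𝒳) (h h' : 𝒳 → Bool) : Finset (Fin n) :=
  univ.filter fun i => h (x i) ≠ h' (x i)

/-- The points that a classifier misclassifies. -/
def errSet (x : Fin n → 𝒳) (y : Fin n → Bool) (h : 𝒳 → Bool) : Finset (Fin n) :=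
  univ.filter fun i => h (x i) ≠ y i

lemma hypDist_eq (x : Fin n → 𝒳) (h h' : 𝒳 → Bool) :
    hypDist x h h' = ((diffSet x h h').card : ℝ) / n := by
  unfold hypDist diffSet
  congr!

lemma err_eq (x : Fin n → 𝒳) (y : Fin n → Bool) (T : Finset (Fin n)) (h : 𝒳 → Bool) :
    err x y T h = ((errSet x y h ∩ T).card : ℝ) / T.card := by
  unfold err errSet
  congr 3
  ext i
  simp [and_comm]

lemma mem_disRegion (x : Fin n → 𝒳) (V : Set (𝒳 → Bool)) (i : Fin n) :
    i ∈ disRegion x V ↔ ∃ h₁ ∈ V, ∃ h₂ ∈ V, h₁ (x i) ≠ h₂ (x i) := by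
  simp [disRegion]

lemma disRegion_mono (x : Fin n → 𝒳) {V W : Set (𝒳 → Bool)} (h : V ⊆ W) :
    disRegion x V ⊆ disRegion x W := by
  intro i hi
  rw [mem_disRegion] at hi ⊢
  obtain ⟨a, ha, b, hb, hab⟩ := hi
  exact ⟨a, h ha, b, h hb, hab⟩

lemma diffSet_subset_disRegion (x : Fin n → 𝒳) {V : Set (𝒳 → Bool)} {h h' : 𝒳 → Bool}
    (hh : h ∈ V) (hh' : h' ∈ V) : diffSet x h h' ⊆ disRegion x V := by
  intro i hi
  exact (mem_disRegion x V i).2 ⟨h, hh, h', hh', (mem_filter.1 hi).2⟩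

lemma diffSet_comm (x : Fin n → 𝒳) (h h' : 𝒳 → Bool) : diffSet x h h' = diffSet x h' h := by
  ext i; simp [diffSet, ne_comm]

lemma diffSet_self (x : Fin n → 𝒳) (h : 𝒳 → Bool) : diffSet x h h = ∅ := by
  simp [diffSet]

lemma card_disRegion_le (x : Fin n → 𝒳) (V : Set (𝒳 → Bool)) : (disRegion x V).card ≤ n := by
  simpa using card_le_univ (disRegion x V)

/-- Boundedness is what makes the real suprema meaningful. Below radius `1/n` a ball contains only
classifiers that agree on the dataset; above it the ratio is at most `n`. -/
lemma disCoeffAt_term_le (x : Fin n → 𝒳) (H : Set (𝒳 → Bool)) (h : 𝒳 → Bool)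
    (r : {r : ℝ // 0 < r}) :
    ((disRegion x (hypBall x H h r)).card : ℝ) / ((r : ℝ) * (n : ℝ)) ≤ n := by
  obtain ⟨r, hr⟩ := r
  dsimp only
  by_cases h1 : r * n < 1
  · have : disRegion x (hypBall x H h r) = ∅ := by
      rw [eq_empty_iff_forall_notMem]
      intro i hi
      have hn : (0 : ℝ) < n := by exact_mod_cast i.pos
      have hz : ∀ k ∈ hypBall x H h r, h (x i) = k (x i) := by
        intro k hk
        have h2 := hk.2
        rw [hypDist_eq, div_le_iff₀ hn] at h2
        have h3 : (diffSet x h k).card < 1 := by exact_mod_cast h2.trans_lt h1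
        by_contra hne
        have : i ∈ diffSet x h k := by simp [diffSet, hne]
        exact absurd (card_pos.2 ⟨i, this⟩) (by omega)
      obtain ⟨a, ha, b, hb, hab⟩ := (mem_disRegion x _ i).1 hi
      exact hab ((hz a ha).symm.trans (hz b hb))
    simp [this]
  · have h2 : ((disRegion x (hypBall x H h r)).card : ℝ) ≤ n := by
      exact_mod_cast card_disRegion_le x _
    exact (div_le_self (by positivity) (not_lt.1 h1)).trans h2

lemma disCoeffAt_le (x : Fin n → 𝒳) (H : Set (𝒳 → Bool)) (h : 𝒳 → Bool) :
    disCoeffAt x H h ≤ n :=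
  Real.iSup_le (disCoeffAt_term_le x H h) (Nat.cast_nonneg n)

lemma disCoeff_nonneg (x : Fin n → 𝒳) (H : Set (𝒳 → Bool)) : 0 ≤ disCoeff x H :=
  Real.iSup_nonneg fun _ => Real.iSup_nonneg fun r => by
    have := r.2; positivity

/-- The defining property of the disagreement coefficient. -/
lemma card_disRegion_ball_le (x : Fin n → 𝒳) (H : Set (𝒳 → Bool)) {h : 𝒳 → Bool} (hh : h ∈ H)
    {r : ℝ} (hr : 0 < r) :
    ((disRegion x (hypBall x H h r)).card : ℝ) ≤ disCoeff x H * (r * n) := by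
  rcases Nat.eq_zero_or_pos n with rfl | hn
  · have := card_disRegion_le x (hypBall x H h r)
    simp [Nat.le_zero.1 this]
  have hn' : (0 : ℝ) < n := by exact_mod_cast hn
  rw [← div_le_iff₀ (by positivity)]
  have h1 : ((disRegion x (hypBall x H h r)).card : ℝ) / (r * n) ≤ disCoeffAt x H h :=
    le_ciSup (f := fun r : {r : ℝ // 0 < r} =>
      ((disRegion x (hypBall x H h r)).card : ℝ) / ((r : ℝ) * (n : ℝ)))
      ⟨n, by rintro _ ⟨r, rfl⟩; exact disCoeffAt_term_le x H h r⟩ ⟨r, hr⟩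
  have h2 : disCoeffAt x H h ≤ disCoeff x H :=
    le_ciSup (f := fun h : H => disCoeffAt x H h)
      ⟨n, by rintro _ ⟨k, rfl⟩; exact disCoeffAt_le x H k⟩ ⟨h, hh⟩
  exact h1.trans h2

/-- Take two classifiers that differ and the ball around one that just reaches the other: its
disagreement region contains their difference set. -/
lemma one_le_disCoeff (x : Fin n → 𝒳) (H : Set (𝒳 → Bool)) (hD : (disRegion x H).Nonempty) :
    1 ≤ disCoeff x H := by
  obtain ⟨i, hi⟩ := hD
  have hn : (0 : ℝ) < n := by exact_mod_cast i.pos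
  obtain ⟨a, ha, b, hb, hab⟩ := (mem_disRegion x _ i).1 hi
  have hpos : (0 : ℝ) < (diffSet x a b).card := by
    exact_mod_cast card_pos.2 ⟨i, by simp [diffSet, hab]⟩
  set r : ℝ := hypDist x a b with hrdef
  have hr : 0 < r := by rw [hrdef, hypDist_eq]; positivity
  have h1 := card_disRegion_ball_le x H ha hr
  have h2 : diffSet x a b ⊆ disRegion x (hypBall x H a r) := by
    refine diffSet_subset_disRegion x ⟨ha, ?_⟩ ⟨hb, le_rfl⟩
    rw [hypDist_eq, diffSet_self]; simpa using hr.le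
  have h3 : ((diffSet x a b).card : ℝ) ≤ (disRegion x (hypBall x H a r)).card := by
    exact_mod_cast card_le_card h2
  have h4 : r * n = (diffSet x a b).card := by rw [hrdef, hypDist_eq]; field_simp
  rw [h4] at h1
  by_contra hlt
  push Not at hlt
  nlinarith

lemma one_le_vcDim (x : Fin n → 𝒳) (H : Set (𝒳 → Bool)) (hH : vcDim H ≠ ⊤)
    (hD : (disRegion x H).Nonempty) : 1 ≤ (vcDim H).toNat := by
  obtain ⟨i, hi⟩ := hD
  obtain ⟨a, ha, b, hb, hab⟩ := (mem_disRegion x _ i).1 hi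
  have hs : Shatters H {x i} := by
    intro f
    by_cases h : a (x i) = f (x i)
    · exact ⟨a, ha, by simpa using h⟩
    · refine ⟨b, hb, ?_⟩
      have : b (x i) = f (x i) := by
        revert h hab
        cases a (x i) <;> cases b (x i) <;> cases f (x i) <;> simp
      simpa using this
  have h1 : (1 : ℕ∞) ≤ vcDim H := by
    have := le_iSup₂ (f := fun (T : Finset 𝒳) (_ : Shatters H T) => (T.card : ℕ∞)) {x i} hs
    simpa [vcDim] using this
  rw [← ENat.natCast_toNat hH] at h1
  exact_mod_cast h1

/-- The error sets of the classifiers in `V`. -/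
noncomputable def errSets (x : Fin n → 𝒳) (y : Fin n → Bool) (V : Set (𝒳 → Bool)) : Finset (Finset (Fin n)) :=
  (Set.toFinite (errSet x y '' V)).toFinset

lemma mem_errSets (x : Fin n → 𝒳) (y : Fin n → Bool) (V : Set (𝒳 → Bool)) (A : Finset (Fin n)) :
    A ∈ errSets x y V ↔ ∃ h ∈ V, errSet x y h = A := by
  simp [errSets]

/-- Comparing with `y` is a bijection between label patterns and error patterns. The dataset may
repeat points, but shattering separates indices, so `x` is injective on `s`. -/
lemma card_le_vcDim_of_shatters (x : Fin n → 𝒳) (y : Fin n → Bool) {V H : Set (𝒳 → Bool)}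
    (hVH : V ⊆ H) (hH : vcDim H ≠ ⊤) (s : Finset (Fin n)) (hs : (errSets x y V).Shatters s) :
    s.card ≤ (vcDim H).toNat := by
  classical
  have hreal : ∀ f : Fin n → Bool, ∃ h ∈ H, ∀ i ∈ s, h (x i) = f i := by
    intro f
    obtain ⟨A, hA, hsA⟩ := hs (filter_subset (fun i => f i ≠ y i) s)
    obtain ⟨h, hh, rfl⟩ := (mem_errSets x y V A).1 hA
    refine ⟨h, hVH hh, fun i hi => ?_⟩
    have := congrArg (i ∈ ·) hsA
    simp only [mem_inter, hi, true_and, errSet, mem_filter, mem_univ, eq_iff_iff] at this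
    revert this
    cases h (x i) <;> cases f i <;> cases y i <;> simp
  have hinj : Set.InjOn x s := by
    intro i hi j hj hij
    by_contra hne
    obtain ⟨h, -, hh⟩ := hreal fun k => decide (k = i)
    have h1 := hh i hi
    have h2 := hh j hj
    rw [← hij, h1] at h2
    simp [Ne.symm hne] at h2
  have hsh : Shatters H (s.image x) := by
    intro f
    obtain ⟨h, hh, hf⟩ := hreal fun i => f (x i)
    refine ⟨h, hh, ?_⟩
    simpa using hf
  have h1 := le_iSup₂ (f := fun (T : Finset 𝒳) (_ : Shatters H T) => (T.card : ℕ∞)) _ hsh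
  change _ ≤ vcDim H at h1
  rw [card_image_of_injOn hinj, ← ENat.natCast_toNat hH] at h1
  exact_mod_cast h1

/-! ### Classes with disagreement coefficient near one -/

/-- If the disagreement coefficient is close to one, then there are two classifiers one of which is
close to any given one. -/
lemma exists_two_centres (x : Fin n → 𝒳) {V H : Set (𝒳 → Bool)} (hVH : V ⊆ H)
    (hD : (disRegion x V).Nonempty) (η : ℝ) (hη : disCoeff x H ≤ 1 + η) :
    ∃ p ∈ V, ∃ q ∈ V, 0 < (diffSet x p q).card ∧ ∀ h ∈ V,
      ((diffSet x p h).card : ℝ) ≤ 2 * η * (diffSet x p q).card ∨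
      ((diffSet x q h).card : ℝ) ≤ 2 * η * (diffSet x p q).card := by
  obtain ⟨i, hi⟩ := hD
  have hn : (0 : ℝ) < n := by exact_mod_cast i.pos
  obtain ⟨a, ha, b, hb, hab⟩ := (mem_disRegion x _ i).1 hi
  -- The centres are a pair at maximal distance.
  obtain ⟨L, ⟨⟨p, q⟩, ⟨hp, hq⟩, hL⟩, hmax⟩ :
      ∃ L, IsGreatest ((fun z : (𝒳 → Bool) × (𝒳 → Bool) => (diffSet x z.1 z.2).card) '' (V ×ˢ V))
        L := by
    have hbdd : BddAbove ((fun z : (𝒳 → Bool) × (𝒳 → Bool) =>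
        (diffSet x z.1 z.2).card) '' (V ×ˢ V)) := by
      refine ⟨n, ?_⟩
      rintro _ ⟨z, -, rfl⟩
      simpa using card_le_univ (diffSet x z.1 z.2)
    exact ⟨_, Nat.sSup_mem ⟨_, (a, b), ⟨ha, hb⟩, rfl⟩ hbdd, fun _ h => le_csSup hbdd h⟩
  dsimp only at hp hq hL
  subst hL
  have hmax' : ∀ h ∈ V, ∀ k ∈ V, (diffSet x h k).card ≤ (diffSet x p q).card :=
    fun h hh k hk => hmax ⟨(h, k), ⟨hh, hk⟩, rfl⟩
  have hpos : 0 < (diffSet x p q).card :=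
    (card_pos.2 ⟨i, by simp [diffSet, hab]⟩).trans_le (hmax' a ha b hb)
  refine ⟨p, hp, q, hq, hpos, ?_⟩
  have main : ∀ h ∈ V, ∀ p ∈ V, ∀ q ∈ V, (diffSet x h p).card ≤ (diffSet x h q).card →
      (diffSet x h q).card ≤ (diffSet x p q).card → 0 < (diffSet x p q).card →
      ((diffSet x p h).card : ℝ) ≤ 2 * η * (diffSet x p q).card := by
    intro h hh p hp q hq huv hvL hpos
    -- Labels are binary, so each point lies in none or exactly two of the three difference sets.
    -- The ball around `h` reaching `q` contains `p` too, so this union has at most `(1 + η)` times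
    -- the size of `diffSet x h q`. That leaves little room for `diffSet x h p`.
    have hW : 2 * (diffSet x h p ∪ diffSet x h q).card =
        (diffSet x h p).card + (diffSet x h q).card + (diffSet x p q).card := by
      simp only [diffSet, ← filter_or, card_filter, ← sum_add_distrib, mul_sum]
      refine sum_congr rfl fun i _ => ?_
      cases h (x i) <;> cases p (x i) <;> cases q (x i) <;> simp
    have hWle := card_union_le (diffSet x h p) (diffSet x h q)
    have hv : 0 < (diffSet x h q).card := by omega
    set r : ℝ := hypDist x h q with hr
    have hrn : r * n = (diffSet x h q).card := by rw [hr, hypDist_eq]; field_simp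
    have hr0 : 0 < r := by
      rw [hr, hypDist_eq]
      have : (0 : ℝ) < (diffSet x h q).card := by exact_mod_cast hv
      positivity
    have hh' : h ∈ hypBall x H h r := ⟨hVH hh, by
      rw [hypDist_eq, diffSet_self]; simpa using hr0.le⟩
    have hp' : p ∈ hypBall x H h r := ⟨hVH hp, by
      rw [hr, hypDist_eq, hypDist_eq]; gcongr⟩
    have hq' : q ∈ hypBall x H h r := ⟨hVH hq, le_rfl⟩
    have h1 := card_disRegion_ball_le x H (hVH hh) hr0
    rw [hrn] at h1
    have h2 : (diffSet x h p ∪ diffSet x h q).card ≤ (disRegion x (hypBall x H h r)).card :=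
      card_le_card (union_subset (diffSet_subset_disRegion x hh' hp')
        (diffSet_subset_disRegion x hh' hq'))
    have h2' : ((diffSet x h p ∪ diffSet x h q).card : ℝ) ≤
      (disRegion x (hypBall x H h r)).card := by exact_mod_cast h2
    have hW' : 2 * ((diffSet x h p ∪ diffSet x h q).card : ℝ) =
        (diffSet x h p).card + (diffSet x h q).card + (diffSet x p q).card := by
      exact_mod_cast hW
    have hvL' : ((diffSet x h q).card : ℝ) ≤ (diffSet x p q).card := by exact_mod_cast hvL
    have hv' : (0 : ℝ) < (diffSet x h q).card := by exact_mod_cast hv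
    have hη0 : 0 ≤ η := by
      have := one_le_disCoeff x H ⟨i, disRegion_mono x hVH hi⟩
      linarith
    rw [diffSet_comm x p h]
    have h3 := mul_le_mul_of_nonneg_right hη hv'.le
    nlinarith
  intro h hh
  rcases le_total (diffSet x h p).card (diffSet x h q).card with h1 | h1
  · exact Or.inl (main h hh p hp q hq h1 (hmax' h hh q hq) hpos)
  · refine Or.inr ?_
    rw [diffSet_comm x p q] at hpos hmax' ⊢
    exact main h hh q hq p hp h1 (hmax' h hh p hp) hpos

/-- A classifier close to `p` has almost the same error as `p` on any sample. -/
lemma abs_card_errSet_sub_le (x : Fin n → 𝒳) (y : Fin n → Bool) (T E : Finset (Fin n))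
    (p h : 𝒳 → Bool) (hE : diffSet x p h ⊆ E) :
    |((errSet x y h ∩ T).card : ℝ) - (errSet x y p ∩ T).card| ≤ (E ∩ T).card := by
  have key : ∀ a b : 𝒳 → Bool, diffSet x a b ⊆ E →
      ((errSet x y b ∩ T).card : ℝ) ≤ (errSet x y a ∩ T).card + (E ∩ T).card := by
    intro a b hab
    have : errSet x y b ∩ T ⊆ (errSet x y a ∩ T) ∪ (E ∩ T) := by
      intro i hi
      obtain ⟨h1, h2⟩ := mem_inter.1 hi
      by_cases h3 : a (x i) = b (x i)
      · refine mem_union_left _ (mem_inter.2 ⟨?_, h2⟩)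
        simp only [errSet, mem_filter, mem_univ, true_and] at h1 ⊢
        rwa [h3]
      · exact mem_union_right _ (mem_inter.2 ⟨hab (by simp [diffSet, h3]), h2⟩)
    exact_mod_cast (card_le_card this).trans (card_union_le _ _)
  have h1 := key p h hE
  have h2 := key h p (by rwa [diffSet_comm])
  rw [abs_le]
  constructor <;> linarith

/-! ### Sample sizes that suffice for uniform deviation -/

lemma uniformSubset_toOuterMeasure_le {ι : Type} (R : Finset ι) (m : ℕ) (S : Set (Finset ι))
    [DecidablePred (· ∈ S)] (q : ℝ)
    (h1 : m < R.card →
      (((R.powersetCard m).filter (· ∈ S)).card : ℝ) ≤ q * (R.powersetCard m).card)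
    (h2 : R.card ≤ m → R ∉ S) :
    (uniformSubset R m).toOuterMeasure S ≤ ENNReal.ofReal q := by
  unfold uniformSubset
  rw [PMF.toOuterMeasure_uniformOfFinset_apply]
  rcases lt_or_ge m R.card with h | h
  · have h3 := h1 h
    rw [min_eq_left h.le]
    have hK : 0 < (R.powersetCard m).card := card_pos.2 (powersetCard_nonempty.2 h.le)
    refine ENNReal.div_le_of_le_mul ?_
    rw [← ENNReal.ofReal_natCast, ← ENNReal.ofReal_natCast (R.powersetCard m).card,
      ← ENNReal.ofReal_mul' (Nat.cast_nonneg _)]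
    refine ENNReal.ofReal_le_ofReal ?_
    convert h3
  · have h3 := h2 h
    rw [min_eq_right h, powersetCard_self, filter_singleton, if_neg h3]
    simp

/-- With `z = a ^ 2 / 8` in the trace bound, the growth factor `(1 + z) ^ (2 * m)` consumes only
half of the exponent `a ^ 2 * m / 2`. -/
lemma card_deviation_le_of_shatters {ι : Type*} [Fintype ι] [DecidableEq ι]
    (𝒜 : Finset (Finset ι)) (R : Finset ι) (d : ℕ)
    (hd : ∀ s, 𝒜.Shatters s → s.card ≤ d) (m : ℕ) (hm : 0 < m) (hmR : m ≤ R.card) (a : ℝ)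
    (ha : 0 < a) (ha1 : a ≤ 1) :
    (((R.powersetCard m).filter fun T =>
      ∃ A ∈ 𝒜, a < |((A ∩ T).card : ℝ) / m - ((A ∩ R).card : ℝ) / R.card|).card : ℝ) ≤
      2 * Real.exp (d * Real.log (8 / a ^ 2) - a ^ 2 * m / 4) * (R.powersetCard m).card := by
  have hz : 0 < a ^ 2 / 8 := by positivity
  have hz1 : a ^ 2 / 8 ≤ 1 := by nlinarith
  refine (card_deviation_le 𝒜 R m hm hmR _ (fun U hU => (card_traces_le 𝒜 d hd U _ hz hz1).trans
    (mul_le_mul_of_nonneg_left (pow_le_pow_right₀ (by linarith) hU) (by positivity))) a ha).trans ?_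
  refine mul_le_mul_of_nonneg_right ?_ (Nat.cast_nonneg _)
  have e1 : ((a ^ 2 / 8) ^ d)⁻¹ = Real.exp (d * Real.log (8 / a ^ 2)) := by
    rw [← inv_pow, inv_div, Real.exp_nat_mul, Real.exp_log (by positivity)]
  have e2 : (1 + a ^ 2 / 8) ^ (2 * m) ≤ Real.exp (a ^ 2 * m / 4) := by
    calc (1 + a ^ 2 / 8) ^ (2 * m) ≤ Real.exp (a ^ 2 / 8) ^ (2 * m) := by
          refine pow_le_pow_left₀ (by positivity) ?_ _
          linarith [Real.add_one_le_exp (a ^ 2 / 8)]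
      _ = _ := by rw [← Real.exp_nat_mul]; congr 1; push_cast; ring
  rw [e1, sub_eq_add_neg, Real.exp_add]
  have e3 : Real.exp (a ^ 2 * m / 4) * Real.exp (-(a ^ 2 * m / 2)) =
      Real.exp (-(a ^ 2 * m / 4)) := by
    rw [← Real.exp_add]; congr 1; ring
  calc 2 * (Real.exp (d * Real.log (8 / a ^ 2)) * (1 + a ^ 2 / 8) ^ (2 * m)) *
        Real.exp (-(a ^ 2 * m / 2))
      ≤ 2 * (Real.exp (d * Real.log (8 / a ^ 2)) * Real.exp (a ^ 2 * m / 4)) *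
        Real.exp (-(a ^ 2 * m / 2)) := by gcongr
    _ = 2 * Real.exp (d * Real.log (8 / a ^ 2)) *
        (Real.exp (a ^ 2 * m / 4) * Real.exp (-(a ^ 2 * m / 2))) := by ring
    _ = _ := by rw [e3]; ring

/-- Since `Real.log ρ` is bounded away from zero, the constants, including the `10 * d` from the
trace bound, are absorbed by `d * Real.log ρ`; this is where `1 ≤ d` enters. -/
lemma exp_bound_of_large_ratio (d : ℕ) (hd : 1 ≤ d) (ρ p m : ℝ) (hρ : 1 + 1 / 2048 ≤ ρ)
    (hp : 0 < p) (hp1 : p ≤ 1)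
    (hm : 2 * 10 ^ 8 * ρ ^ 2 * (d * Real.log ρ + Real.log (1 / p)) ≤ m) :
    2 * Real.exp (d * Real.log (8 / (1 / (32 * ρ)) ^ 2) - (1 / (32 * ρ)) ^ 2 * m / 4) ≤ p / 3 := by
  have hρ0 : 0 < ρ := by linarith
  have hd' : (1 : ℝ) ≤ d := by exact_mod_cast hd
  have hlp : 0 ≤ Real.log (1 / p) := Real.log_nonneg (by rw [le_div_iff₀ hp]; linarith)
  have hlρ : 1 / 2049 ≤ Real.log ρ := by
    have h1 := Real.one_sub_inv_le_log_of_pos hρ0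
    have h2 : ρ⁻¹ ≤ 2048 / 2049 := by
      rw [inv_le_comm₀ hρ0 (by norm_num)]
      norm_num at hρ ⊢
      exact hρ
    linarith
  have e1 : Real.log (8 / (1 / (32 * ρ)) ^ 2) ≤ 10 + 2 * Real.log ρ := by
    have : 8 / (1 / (32 * ρ)) ^ 2 = 2 ^ 13 * ρ ^ 2 := by field_simp; norm_num
    rw [this, Real.log_mul (by norm_num) (by positivity), Real.log_pow, Real.log_pow]
    have := Real.log_two_lt_d9
    push_cast
    linarith
  have e2 : (1 / (32 * ρ)) ^ 2 * m / 4 = m / (4096 * ρ ^ 2) := by field_simp; ring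
  have e3 : 48000 * (d * Real.log ρ + Real.log (1 / p)) ≤ m / (4096 * ρ ^ 2) := by
    rw [le_div_iff₀ (by positivity)]
    have h0 : 0 ≤ ρ ^ 2 * (d * Real.log ρ + Real.log (1 / p)) := by
      have : 0 ≤ Real.log ρ := by linarith
      positivity
    nlinarith
  have e4 : Real.log 6 ≤ 3 := by
    have h1 : Real.log 6 ≤ Real.log (2 ^ 3) := Real.log_le_log (by norm_num) (by norm_num)
    rw [Real.log_pow] at h1
    have := Real.log_two_lt_d9
    push_cast at h1
    linarith
  have e5 : p / 6 = Real.exp (-(Real.log (1 / p) + Real.log 6)) := by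
    rw [neg_add, Real.exp_add, Real.exp_neg, Real.exp_neg, Real.exp_log (by positivity),
      Real.exp_log (by norm_num)]
    field_simp
  have e6 : Real.exp (d * Real.log (8 / (1 / (32 * ρ)) ^ 2) - (1 / (32 * ρ)) ^ 2 * m / 4) ≤
      p / 6 := by
    rw [e5, Real.exp_le_exp, e2]
    have h1 := mul_le_mul_of_nonneg_left e1 (show (0 : ℝ) ≤ d by linarith)
    have h2 : (d : ℝ) * (1 / 2049) ≤ d * Real.log ρ :=
      mul_le_mul_of_nonneg_left hlρ (by linarith)
    linarith
  linarith

lemma exp_bound_of_small_ratio (p m : ℝ) (hp : 0 < p) (hp1 : p ≤ 1)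
    (hm : 2 * 10 ^ 8 * Real.log (1 / p) + 10 ^ 7 ≤ m) :
    2 * 4 * Real.exp (-((1 / 512) ^ 2 * m / 2)) ≤ p / 3 := by
  have hlp : 0 ≤ Real.log (1 / p) := Real.log_nonneg (by rw [le_div_iff₀ hp]; linarith)
  have e4 : Real.log 24 ≤ 4 := by
    have h1 : Real.log 24 ≤ Real.log (2 ^ 5) := Real.log_le_log (by norm_num) (by norm_num)
    rw [Real.log_pow] at h1
    have := Real.log_two_lt_d9
    push_cast at h1
    linarith
  have e5 : p / 24 = Real.exp (-(Real.log (1 / p) + Real.log 24)) := by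
    rw [neg_add, Real.exp_add, Real.exp_neg, Real.exp_neg, Real.exp_log (by positivity),
      Real.exp_log (by norm_num)]
    field_simp
  have e6 : Real.exp (-((1 / 512) ^ 2 * m / 2)) ≤ p / 24 := by
    rw [e5, Real.exp_le_exp]
    linarith
  linarith

/-- The uniform deviation bound of the algorithm: a sample of the prescribed size determines the
errors of all candidates on the disagreement region. -/
theorem uniformSubset_deviation_le (x : Fin n → 𝒳) (y : Fin n → Bool) {V H : Set (𝒳 → Bool)}
    (hVH : V ⊆ H) (hH : vcDim H ≠ ⊤) (hD : (disRegion x V).Nonempty) (ε p : ℝ) (hε : 0 < ε)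
    (hε1 : ε ≤ 1) (hp : 0 < p) (hp1 : p ≤ 1) (m : ℕ)
    (hm : 2 * 10 ^ 8 * disCoeff x H ^ 2 / ε ^ 2 * (((vcDim H).toNat : ℝ) *
      Real.log (disCoeff x H / ε) + Real.log (1 / p)) + 10 ^ 7 ≤ m) :
    (uniformSubset (disRegion x V) m).toOuterMeasure
      {T | ∃ h ∈ V, ε / (32 * disCoeff x H) <
        |err x y T h - err x y (disRegion x V) h|} ≤ ENNReal.ofReal (p / 3) := by
  classical
  have hDH : (disRegion x H).Nonempty := hD.mono (disRegion_mono x hVH)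
  have hθ := one_le_disCoeff x H hDH
  have hd := one_le_vcDim x H hH hDH
  set θ := disCoeff x H with hθdef
  set d := (vcDim H).toNat
  set D := disRegion x V with hDdef
  set ρ := θ / ε with hρdef
  have hρ1 : 1 ≤ ρ := by rw [hρdef, le_div_iff₀ hε]; linarith
  have hθρ : 2 * 10 ^ 8 * θ ^ 2 / ε ^ 2 = 2 * 10 ^ 8 * ρ ^ 2 := by
    rw [hρdef]; field_simp
  have haρ : ε / (32 * θ) = 1 / (32 * ρ) := by
    rw [hρdef]; field_simp
  have ha0 : 0 < 1 / (32 * ρ) := by positivity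
  have ha1 : 1 / (32 * ρ) ≤ 1 := by
    rw [div_le_one (by positivity)]; linarith
  rw [hθρ] at hm
  rw [haρ]
  have hlp : 0 ≤ Real.log (1 / p) := Real.log_nonneg (by rw [le_div_iff₀ hp]; linarith)
  have hlρ : 0 ≤ Real.log ρ := Real.log_nonneg hρ1
  have hm' : 2 * 10 ^ 8 * Real.log (1 / p) + 10 ^ 7 ≤ (m : ℝ) := by
    refine le_trans ?_ hm
    have h1 : 1 * (0 + Real.log (1 / p)) ≤ ρ ^ 2 * (d * Real.log ρ + Real.log (1 / p)) := by
      gcongr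
      · nlinarith
      · positivity
    nlinarith
  have hm0 : 0 < m := by
    have : (0 : ℝ) < m := by linarith
    exact_mod_cast this
  refine uniformSubset_toOuterMeasure_le D m _ _ (fun hlt => ?_) (fun _ => ?_)
  swap
  · rintro ⟨h, -, hh⟩
    rw [sub_self, abs_zero] at hh
    linarith
  have hM : (0 : ℝ) < D.card := by exact_mod_cast card_pos.2 hD
  have hm0' : (0 : ℝ) < m := by exact_mod_cast hm0
  -- For larger `ρ` the VC bound suffices; otherwise the two-centre structure replaces it.
  by_cases hcase : 1 + 1 / 2048 ≤ ρ
  · have h1 := card_deviation_le_of_shatters (errSets x y V) D d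
      (card_le_vcDim_of_shatters x y hVH hH) m hm0 hlt.le _ ha0 ha1
    have h2 := exp_bound_of_large_ratio d hd ρ p m hcase hp hp1 (by linarith)
    refine le_trans ?_ (h1.trans (mul_le_mul_of_nonneg_right h2 (Nat.cast_nonneg _)))
    refine Nat.cast_le.2 (card_le_card fun T hT => ?_)
    rw [mem_filter] at hT ⊢
    refine ⟨hT.1, ?_⟩
    obtain ⟨h, hh, hlt⟩ := hT.2
    refine ⟨errSet x y h, (mem_errSets x y V _).2 ⟨h, hh, rfl⟩, ?_⟩
    rw [err_eq, err_eq, (mem_powersetCard.1 hT.1).2] at hlt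
    exact hlt
  · push Not at hcase
    have hθsmall : θ ≤ 1 + 1 / 2048 := by
      have : θ ≤ ρ := by rw [hρdef, le_div_iff₀ hε]; nlinarith
      linarith
    obtain ⟨u, hu, v, hv, hL, hclose⟩ := exists_two_centres x hVH hD _ hθsmall
    have hn : (0 : ℝ) < n := by
      obtain ⟨i, -⟩ := hD
      exact_mod_cast i.pos
    set L : ℝ := ((diffSet x u v).card : ℝ) with hLdef
    have hL' : 0 < L := by rw [hLdef]; exact_mod_cast hL
    have hLM : L ≤ D.card := by
      rw [hLdef]; exact_mod_cast card_le_card (diffSet_subset_disRegion x hu hv)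
    set r : ℝ := 2 * (1 / 2048) * L / n with hrdef
    have hr : 0 < r := by positivity
    have hrn : r * n = 2 * (1 / 2048) * L := by rw [hrdef]; field_simp
    -- `E k` contains every point where a candidate near the centre `k` differs from `k`; it fills
    -- at most `1 / 512` of `D`.
    set E : (𝒳 → Bool) → Finset (Fin n) := fun k => disRegion x (hypBall x H k r) with hEdef
    have hEcard : ∀ k ∈ V, ((E k ∩ D).card : ℝ) / D.card ≤ 1 / 512 := by
      intro k hk
      rw [div_le_iff₀ hM]
      have h1 := card_disRegion_ball_le x H (hVH hk) hr
      rw [hrn] at h1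
      have h2 : ((E k ∩ D).card : ℝ) ≤ (E k).card := by
        exact_mod_cast card_le_card inter_subset_left
      have h3 : θ * (2 * (1 / 2048) * L) ≤ 2 * (2 * (1 / 2048) * L) := by
        gcongr; linarith
      simp only [hEdef] at h2 ⊢
      linarith
    have hEdiff : ∀ k ∈ V, ∀ h ∈ V, ((diffSet x k h).card : ℝ) ≤ 2 * (1 / 2048) * L →
        diffSet x k h ⊆ E k := by
      intro k hk h hh hle
      refine diffSet_subset_disRegion x ⟨hVH hk, ?_⟩ ⟨hVH hh, ?_⟩
      · rw [hypDist_eq, diffSet_self]; simpa using hr.le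
      · rw [hypDist_eq, hrdef]; gcongr
    set 𝒜 : Finset (Finset (Fin n)) := {errSet x y u, errSet x y v, E u, E v} with h𝒜
    have h1 := card_deviation_le 𝒜 D m hm0 hlt.le 4
      (fun U _ => by exact_mod_cast card_image_le.trans card_le_four) (1 / 512) (by norm_num)
    have h2 := exp_bound_of_small_ratio p m hp hp1 hm'
    refine le_trans ?_ (h1.trans (mul_le_mul_of_nonneg_right h2 (Nat.cast_nonneg _)))
    refine Nat.cast_le.2 (card_le_card fun T hT => ?_)
    rw [mem_filter] at hT ⊢
    refine ⟨hT.1, ?_⟩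
    by_contra hcon
    push Not at hcon
    obtain ⟨h, hh, hdev⟩ := hT.2
    have hTm := (mem_powersetCard.1 hT.1).2
    rw [err_eq, err_eq, hTm] at hdev
    have hnear : ∀ k ∈ V, errSet x y k ∈ 𝒜 → E k ∈ 𝒜 → diffSet x k h ⊆ E k → False := by
      intro k hk hk1 hk2 hsub
      have d1 := hcon _ hk1
      have d2 := hcon _ hk2
      have d3 := hEcard k hk
      have d4 := abs_card_errSet_sub_le x y T (E k) k h hsub
      have d5 := abs_card_errSet_sub_le x y D (E k) k h hsub
      have d4' : |((errSet x y h ∩ T).card : ℝ) / m - (errSet x y k ∩ T).card / m| ≤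
          (E k ∩ T).card / m := by
        rw [← sub_div, abs_div, abs_of_pos hm0']
        gcongr
      have d5' : |((errSet x y h ∩ D).card : ℝ) / D.card - (errSet x y k ∩ D).card / D.card| ≤
          (E k ∩ D).card / D.card := by
        rw [← sub_div, abs_div, abs_of_pos hM]
        gcongr
      -- The total is four times `1 / 512`: the deviation of the centre, the deviation of `E k`, and
      -- the density of `E k` in `D` counted twice.
      have d6 : 1 / 128 ≤ 1 / (32 * ρ) := by
        rw [div_le_div_iff₀ (by norm_num) (by positivity)]
        linarith
      rw [abs_le] at d1 d2 d4' d5'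
      have : |((errSet x y h ∩ T).card : ℝ) / m - (errSet x y h ∩ D).card / D.card| ≤ 1 / 128 := by
        rw [abs_le]
        constructor <;> linarith [d1.1, d1.2, d2.1, d2.2, d4'.1, d4'.2, d5'.1, d5'.2]
      linarith
    rcases hclose h hh with hc | hc
    · exact hnear u hu (by simp [h𝒜]) (by simp [h𝒜]) (hEdiff u hu h hh hc)
    · exact hnear v hv (by simp [h𝒜]) (by simp [h𝒜]) (hEdiff v hv h hh hc)

/-! ### Execution of draws and queries -/

/-- The table of labels that is correct on `T`. -/
def labelTable (y : Fin n → Bool) (T : Finset (Fin n)) (i : Fin n) : Bool :=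
  if i ∈ T then y i else false

lemma queryAll_run {ι : Type} {α : Type*} [DecidableEq ι] (y : ι → Bool)
    (k : (ι → Bool) → LabelAlg ι α) (l : List ι) (g : ι → Bool) :
    (queryAll l g k).run y =
      ((k fun i => if i ∈ l then y i else g i).run y).map fun p => (p.1, p.2 + l.length) := by
  induction l generalizing g with
  | nil => simp [queryAll, ← Function.id_def, PMF.map_id]
  | cons i l ih =>
    rw [queryAll, LabelAlg.run, ih, PMF.map_comp]
    congr 1
    congr 2
    funext j
    by_cases h1 : j ∈ l
    · simp [h1]
    · by_cases h2 : j = i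
      · subst h2; simp [h1]
      · simp [h1, h2]

lemma drawAndQuery_run {α : Type*} (y : Fin n → Bool) (R : Finset (Fin n)) (m : ℕ)
    (k : Finset (Fin n) → (Fin n → Bool) → LabelAlg (Fin n) α) :
    (drawAndQuery R m k).run y = (uniformSubset R m).bind fun T =>
      ((k T (labelTable y T)).run y).map fun p => (p.1, p.2 + T.card) := by
  rw [drawAndQuery, LabelAlg.run]
  congr 1
  funext T
  rw [queryAll_run]
  simp only [mem_toList, length_toList]
  rfl

/-- Split according to whether the sample is bad: the bad event contributes at most its own
probability, and the query count does not affect `Q`. -/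
lemma drawAndQuery_toOuterMeasure_le {α : Type*} (y : Fin n → Bool) (R : Finset (Fin n)) (m : ℕ)
    (k : Finset (Fin n) → (Fin n → Bool) → LabelAlg (Fin n) α) (Q : α → Prop)
    (B : Set (Finset (Fin n))) (q₁ q₂ : ENNReal)
    (h1 : (uniformSubset R m).toOuterMeasure B ≤ q₁)
    (h2 : ∀ T ∉ B, ((k T (labelTable y T)).run y).toOuterMeasure {p | Q p.1} ≤ q₂) :
    ((drawAndQuery R m k).run y).toOuterMeasure {p | Q p.1} ≤ q₁ + q₂ := by
  rw [drawAndQuery_run, PMF.toOuterMeasure_bind_apply]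
  have h3 : ∀ T, (((k T (labelTable y T)).run y).map
      fun p => (p.1, p.2 + T.card)).toOuterMeasure {p | Q p.1} =
      ((k T (labelTable y T)).run y).toOuterMeasure {p | Q p.1} := by
    intro T
    rw [PMF.toOuterMeasure_map_apply]
    rfl
  simp only [h3]
  have hle1 : ∀ T, ((k T (labelTable y T)).run y).toOuterMeasure {p | Q p.1} ≤ 1 := by
    intro T
    refine (MeasureTheory.measure_mono (Set.subset_univ _)).trans ?_
    rw [PMF.toOuterMeasure_apply]
    simp [PMF.tsum_coe]
  calc ∑' T, (uniformSubset R m) T *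
        ((k T (labelTable y T)).run y).toOuterMeasure {p | Q p.1}
      ≤ ∑' T, (B.indicator (uniformSubset R m) T + (uniformSubset R m) T * q₂) := by
        refine ENNReal.tsum_le_tsum fun T => ?_
        by_cases hT : T ∈ B
        · rw [Set.indicator_of_mem hT]
          refine le_trans ?_ le_self_add
          exact mul_le_of_le_one_right' (hle1 T)
        · refine le_trans ?_ le_add_self
          gcongr
          exact h2 T hT
    _ = (uniformSubset R m).toOuterMeasure B + q₂ := by
        rw [ENNReal.tsum_add, ENNReal.tsum_mul_right, PMF.tsum_coe, one_mul,
          PMF.toOuterMeasure_apply]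
    _ ≤ q₁ + q₂ := by gcongr

/-- Only labels inside the sample are read, so the analysis may use the true labels in place of the
queried table. -/
lemma err_labelTable (x : Fin n → 𝒳) (y : Fin n → Bool) (T : Finset (Fin n)) (h : 𝒳 → Bool) :
    err x (labelTable y T) T h = err x y T h := by
  unfold err
  congr 3
  refine filter_congr fun i hi => ?_
  simp [labelTable, hi]

lemma prune_labelTable (x : Fin n → 𝒳) (y : Fin n → Bool) (V : Set (𝒳 → Bool))
    (T : Finset (Fin n)) (w : ℝ) : prune x V (labelTable y T) T w = prune x V y T w := by
  have h : UB x (labelTable y T) T w = UB x y T w := by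
    funext h; simp [UB, err_labelTable]
  simp [prune, LB, err_labelTable, h]

lemma argminUB_labelTable (x : Fin n → 𝒳) (y : Fin n → Bool) (V : Set (𝒳 → Bool))
    (T : Finset (Fin n)) (w : ℝ) : argminUB x V (labelTable y T) T w = argminUB x V y T w := by
  simp [argminUB, UB, err_labelTable]

/-! ### One round on a good sample -/

lemma err_nonneg (x : Fin n → 𝒳) (y : Fin n → Bool) (T : Finset (Fin n)) (h : 𝒳 → Bool) :
    0 ≤ err x y T h := by
  rw [err_eq]; positivity

lemma exists_min_err (x : Fin n → 𝒳) (y : Fin n → Bool) (T : Finset (Fin n))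
    {V : Set (𝒳 → Bool)} (hV : V.Nonempty) :
    ∃ h ∈ V, ∀ h' ∈ V, err x y T h ≤ err x y T h' := by
  obtain ⟨A, ⟨h, hh, rfl⟩, hmin⟩ := (Set.toFinite (errSet x y '' V)).exists_minimalFor
    (fun A => ((A ∩ T).card : ℝ) / T.card) _ (hV.image _)
  refine ⟨h, hh, fun h' hh' => ?_⟩
  rw [err_eq, err_eq]
  exact (le_total _ _).elim id fun hle => hmin ⟨h', hh', rfl⟩ hle

lemma argminUB_spec (x : Fin n → 𝒳) (y : Fin n → Bool) (T : Finset (Fin n)) (w : ℝ)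
    {V : Set (𝒳 → Bool)} (hV : V.Nonempty) :
    argminUB x V y T w ∈ V ∧ ∀ h ∈ V, err x y T (argminUB x V y T w) ≤ err x y T h := by
  obtain ⟨h, hh, hmin⟩ := exists_min_err x y T hV
  have := Classical.epsilon_spec (p := fun h => h ∈ V ∧ ∀ h' ∈ V, UB x y T w h ≤ UB x y T w h')
    ⟨h, hh, fun h' hh' => by simpa [UB] using hmin h' hh'⟩
  exact ⟨this.1, fun h' hh' => by simpa [UB, argminUB] using this.2 h' hh'⟩

/-- Outside of the disagreement region, the errors of all candidates are equal. -/
lemma mul_err_sub_mul_err (x : Fin n → 𝒳) (y : Fin n → Bool) {V : Set (𝒳 → Bool)}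
    {h k : 𝒳 → Bool} (hh : h ∈ V) (hk : k ∈ V) :
    n * err x y univ h - n * err x y univ k =
      (disRegion x V).card * err x y (disRegion x V) h -
        (disRegion x V).card * err x y (disRegion x V) k := by
  set D := disRegion x V with hD
  have hmul : ∀ (T : Finset (Fin n)) (h : 𝒳 → Bool),
      (T.card : ℝ) * err x y T h = (errSet x y h ∩ T).card := by
    intro T h
    rw [err_eq]
    rcases T.eq_empty_or_nonempty with rfl | hT
    · simp
    · have : (T.card : ℝ) ≠ 0 := by exact_mod_cast (card_pos.2 hT).ne'
      field_simp
  have hn : (n : ℝ) = ((univ : Finset (Fin n)).card : ℝ) := by simp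
  rw [hn, hmul, hmul, hmul, hmul, inter_univ, inter_univ]
  have h1 : errSet x y h \ D = errSet x y k \ D := by
    ext i
    simp only [mem_sdiff, errSet, mem_filter, mem_univ, true_and]
    refine and_congr_left fun hi => ?_
    have : h (x i) = k (x i) := by
      by_contra hne
      exact hi ((mem_disRegion x V i).2 ⟨h, hh, k, hk, hne⟩)
    rw [this]
  have h2 := card_sdiff_add_card_inter (errSet x y h) D
  have h3 := card_sdiff_add_card_inter (errSet x y k) D
  rw [h1] at h2
  have h2' : ((errSet x y k \ D).card : ℝ) + (errSet x y h ∩ D).card = (errSet x y h).card := by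
    exact_mod_cast h2
  have h3' : ((errSet x y k \ D).card : ℝ) + (errSet x y k ∩ D).card = (errSet x y k).card := by
    exact_mod_cast h3
  linarith

lemma card_mul_err_disRegion_le (x : Fin n → 𝒳) (y : Fin n → Bool) (D : Finset (Fin n))
    (h : 𝒳 → Bool) : D.card * err x y D h ≤ n * err x y univ h := by
  have hmul : ∀ (T : Finset (Fin n)), (T.card : ℝ) * err x y T h = (errSet x y h ∩ T).card := by
    intro T
    rw [err_eq]
    rcases T.eq_empty_or_nonempty with rfl | hT
    · simp
    · have : (T.card : ℝ) ≠ 0 := by exact_mod_cast (card_pos.2 hT).ne'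
      field_simp
  have hn : (n : ℝ) = ((univ : Finset (Fin n)).card : ℝ) := by simp
  rw [hn, hmul, hmul]
  exact_mod_cast card_le_card (inter_subset_inter_left (subset_univ D))

lemma card_diffSet_le (x : Fin n → 𝒳) (y : Fin n → Bool) {V : Set (𝒳 → Bool)}
    {h k : 𝒳 → Bool} (hh : h ∈ V) (hk : k ∈ V) :
    ((diffSet x h k).card : ℝ) ≤ (disRegion x V).card * err x y (disRegion x V) h +
        (disRegion x V).card * err x y (disRegion x V) k := by
  set D := disRegion x V with hD
  have hsub := diffSet_subset_disRegion x hh hk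
  have hs : diffSet x h k ⊆ (errSet x y h ∩ D) ∪ (errSet x y k ∩ D) := by
    intro i hi
    have h1 : i ∈ D := hsub hi
    simp only [diffSet, errSet, mem_filter, mem_univ, true_and, mem_union, mem_inter,
      h1, and_true] at hi ⊢
    revert hi
    cases h (x i) <;> cases k (x i) <;> cases y i <;> simp
  rcases D.eq_empty_or_nonempty with hD0 | hD0
  · have h0 : (diffSet x h k).card ≤ 0 := by
      rw [← card_empty (α := Fin n), ← hD0]
      exact card_le_card hsub
    simp [Nat.le_zero.1 h0, hD0]
  · have : (D.card : ℝ) ≠ 0 := by exact_mod_cast (card_pos.2 hD0).ne'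
    rw [err_eq, err_eq, mul_div_cancel₀ _ this, mul_div_cancel₀ _ this]
    exact_mod_cast (card_le_card hs).trans (card_union_le _ _)

lemma radius_nonneg (x : Fin n → 𝒳) (V : Set (𝒳 → Bool)) : 0 ≤ radius x V := by
  refine Real.sInf_nonneg ?_
  rintro r ⟨h, hh, hsub⟩
  have := (hsub hh).2
  rw [hypDist_eq, diffSet_self] at this
  simpa using this

lemma radius_le (x : Fin n → 𝒳) {V : Set (𝒳 → Bool)} {h : 𝒳 → Bool} (hh : h ∈ V) {r : ℝ}
    (hr : ∀ k ∈ V, hypDist x h k ≤ r) : radius x V ≤ r := by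
  refine csInf_le ⟨0, ?_⟩ ⟨h, hh, fun k hk => ⟨hk, hr k hk⟩⟩
  rintro r ⟨h, hh, hsub⟩
  have := (hsub hh).2
  rw [hypDist_eq, diffSet_self] at this
  simpa using this

lemma card_disRegion_le_radius (x : Fin n → 𝒳) {V H : Set (𝒳 → Bool)} (hVH : V ⊆ H)
    (hV : V.Nonempty) : ((disRegion x V).card : ℝ) ≤ disCoeff x H * (radius x V * n) := by
  have hne : {r : ℝ | ∃ h ∈ V, V ⊆ hypBall x V h r}.Nonempty := by
    obtain ⟨h, hh⟩ := hV
    refine ⟨1, h, hh, fun k hk => ⟨hk, ?_⟩⟩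
    rw [hypDist_eq]
    refine div_le_one_of_le₀ ?_ (Nat.cast_nonneg n)
    exact_mod_cast (card_le_univ (diffSet x h k)).trans (by simp)
  -- The disagreement coefficient sees only positive radii; passing to the limit from above also
  -- covers radius zero and avoids attaining the infimum.
  have key : ∀ r, radius x V < r → ((disRegion x V).card : ℝ) ≤ disCoeff x H * (r * n) := by
    intro r hr
    obtain ⟨s, ⟨h, hh, hsub⟩, hs⟩ := exists_lt_of_csInf_lt hne hr
    have h1 := card_disRegion_ball_le x H (hVH hh) ((radius_nonneg x V).trans_lt hr)
    refine le_trans ?_ h1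
    refine Nat.cast_le.2 (card_le_card (disRegion_mono x fun k hk => ⟨hVH hk, ?_⟩))
    exact (hsub hk).2.trans hs.le
  have hcont : Filter.Tendsto (fun r : ℝ => disCoeff x H * (r * n))
      (nhdsWithin (radius x V) (Set.Ioi (radius x V)))
      (nhds (disCoeff x H * (radius x V * n))) := by
    refine Filter.Tendsto.mono_left (Continuous.tendsto ?_ _) nhdsWithin_le_nhds
    fun_prop
  exact ge_of_tendsto hcont (Filter.eventually_of_mem self_mem_nhdsWithin key)

/-- On a good sample, pruning keeps the best candidate. -/
lemma mem_prune (x : Fin n → 𝒳) (y : Fin n → Bool) {V : Set (𝒳 → Bool)} (T D : Finset (Fin n))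
    (w : ℝ) (hT : ∀ h ∈ V, |err x y T h - err x y D h| ≤ w / 2) {k : 𝒳 → Bool} (hk : k ∈ V)
    (hmin : ∀ h ∈ V, err x y D k ≤ err x y D h) : k ∈ prune x V y T w := by
  refine ⟨hk, le_csInf ⟨_, k, hk, rfl⟩ ?_⟩
  rintro _ ⟨h, hh, rfl⟩
  have h1 := (abs_le.1 (hT k hk)).2
  have h2 := (abs_le.1 (hT h hh)).1
  have h3 := hmin h hh
  simp only [LB, UB]
  linarith

/-- On a good sample, all candidates that survive the pruning are almost optimal. -/
lemma err_le_of_mem_prune (x : Fin n → 𝒳) (y : Fin n → Bool) {V : Set (𝒳 → Bool)}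
    (T D : Finset (Fin n)) (w : ℝ) (hT : ∀ h ∈ V, |err x y T h - err x y D h| ≤ w / 2)
    {k h : 𝒳 → Bool} (hk : k ∈ V) (hh : h ∈ prune x V y T w) :
    err x y D h ≤ err x y D k + 2 * w := by
  have h1 := (abs_le.1 (hT k hk)).2
  have h2 := (abs_le.1 (hT h hh.1)).1
  have h3 : LB x y T w h ≤ UB x y T w k := by
    refine hh.2.trans (csInf_le ⟨w / 2, ?_⟩ ⟨k, hk, rfl⟩)
    rintro _ ⟨h, -, rfl⟩
    simp only [UB]
    linarith [err_nonneg x y T h]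
  simp only [LB, UB] at h3
  linarith

/-- If the radius does not decrease enough, then the final estimation is successful. -/
lemma isApprox_argminUB (x : Fin n → 𝒳) (y : Fin n → Bool) {V H : Set (𝒳 → Bool)} (hVH : V ⊆ H)
    (hD : (disRegion x V).Nonempty) {k : 𝒳 → Bool} (hk : k ∈ V)
    (hmin : ∀ h ∈ H, err x y univ k ≤ err x y univ h) {ε r : ℝ} (hε : 0 < ε)
    (hr : ((disRegion x V).card : ℝ) ≤ disCoeff x H * (r * n)) (T T' : Finset (Fin n))
    (hT : ∀ h ∈ V, |err x y T h - err x y (disRegion x V) h| ≤ 1 / (16 * disCoeff x H) / 2)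
    (hT' : ∀ h ∈ V, |err x y T' h - err x y (disRegion x V) h| ≤ ε / (32 * disCoeff x H))
    (hrad : r / 2 < radius x (prune x V y T (1 / (16 * disCoeff x H)))) (w : ℝ) :
    IsApproxClassifier x y H ε (argminUB x V y T' w) := by
  obtain ⟨i, hi⟩ := hD
  have hn : (0 : ℝ) < n := by exact_mod_cast i.pos
  have hθ := one_le_disCoeff x H ⟨i, disRegion_mono x hVH hi⟩
  set θ := disCoeff x H
  set D := disRegion x V with hDdef
  have hM : (0 : ℝ) < D.card := by exact_mod_cast card_pos.2 ⟨i, hi⟩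
  set M : ℝ := (D.card : ℝ)
  set ν := err x y D k with hν
  have hdecomp : ∀ h ∈ V, n * err x y univ h - n * err x y univ k = M * err x y D h - M * ν :=
    fun h hh => mul_err_sub_mul_err x y hh hk
  have hkD : ∀ h ∈ V, err x y D k ≤ err x y D h := by
    intro h hh
    have h1 := hdecomp h hh
    have h2 := mul_le_mul_of_nonneg_left (hmin h (hVH hh)) hn.le
    exact le_of_mul_le_mul_left (by linarith) hM
  have hkp := mem_prune x y T D _ hT hk hkD
  have hradle : radius x (prune x V y T (1 / (16 * θ))) ≤
      (M * (2 * ν + 2 * (1 / (16 * θ)))) / n := by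
    refine radius_le x hkp fun h hh => ?_
    rw [hypDist_eq]
    gcongr
    have h1 := card_diffSet_le x y hk hh.1
    have h2 := err_le_of_mem_prune x y T D _ hT hk hh
    have h3 := mul_le_mul_of_nonneg_left h2 hM.le
    refine h1.trans ?_
    rw [← hDdef]
    linarith
  have h1 : r / 2 * n < M * (2 * ν + 2 * (1 / (16 * θ))) := by
    rw [← lt_div_iff₀ hn]
    exact hrad.trans_le hradle
  have h2 : M * (1 / (16 * θ)) ≤ r * n / 16 := by
    rw [mul_one_div, div_le_iff₀ (by positivity)]
    linarith
  -- From `h1` and `h2`: half of `r * n / 2 - r * n / 8`.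
  have h3 : 3 * (r * n) / 16 < M * ν := by linarith
  have h4 : M * ν ≤ n * err x y univ k := card_mul_err_disRegion_le x y D k
  obtain ⟨hmem, hbest⟩ := argminUB_spec x y T' w ⟨k, hk⟩
  set h := argminUB x V y T' w
  have h5 : err x y D h ≤ ν + ε * (1 / (16 * θ)) := by
    have a1 := (abs_le.1 (hT' h hmem)).1
    have a2 := (abs_le.1 (hT' k hk)).2
    have a3 := hbest k hk
    have a4 : ε * (1 / (16 * θ)) = 2 * (ε / (32 * θ)) := by field_simp; norm_num
    rw [a4]
    linarith
  refine ⟨hVH hmem, fun h' hh' => ?_⟩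
  have h6 := mul_le_mul_of_nonneg_left h5 hM.le
  have h7 := hdecomp h hmem
  have h8 := mul_le_mul_of_nonneg_left h2 hε.le
  have h9 : n * err x y univ h ≤ n * ((1 + ε) * err x y univ k) := by
    have := mul_le_mul_of_nonneg_left (h3.le.trans h4) hε.le
    have hk0 := mul_nonneg (mul_nonneg hε.le hn.le) (err_nonneg x y univ k)
    nlinarith
  refine (le_of_mul_le_mul_left h9 hn).trans ?_
  exact mul_le_mul_of_nonneg_left (hmin h' hh') (by linarith)

/-! ### Failure probability and query count of the loop -/

/-- The failure probability of the loop. -/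
theorem loop_failure_le (x : Fin n → 𝒳) (y : Fin n → Bool) (H : Set (𝒳 → Bool)) (m₁ m₂ : ℕ)
    (ε q₁ q₂ : ℝ) (hε : 0 < ε) (hq₁ : 0 ≤ q₁) (hq₂ : 0 ≤ q₂) (k₀ : 𝒳 → Bool)
    (hmin : ∀ h ∈ H, err x y univ k₀ ≤ err x y univ h)
    (hs₁ : ∀ V ⊆ H, (disRegion x V).Nonempty → (uniformSubset (disRegion x V) m₁).toOuterMeasure
      {T | ∃ h ∈ V, 1 / (32 * disCoeff x H) < |err x y T h - err x y (disRegion x V) h|} ≤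
        ENNReal.ofReal q₁)
    (hs₂ : ∀ V ⊆ H, (disRegion x V).Nonempty → (uniformSubset (disRegion x V) m₂).toOuterMeasure
      {T | ∃ h ∈ V, ε / (32 * disCoeff x H) < |err x y T h - err x y (disRegion x V) h|} ≤
        ENNReal.ofReal q₂) (w₂ : ℝ) (j : ℕ) :
    ∀ (V : Set (𝒳 → Bool)) (r : ℝ), V ⊆ H → k₀ ∈ V →
      ((disRegion x V).card : ℝ) ≤ disCoeff x H * (r * n) →
      ((disRegion x V).Nonempty → 1 ≤ n * r) → n * r < 2 ^ j →
      ((loop x m₁ m₂ (1 / (16 * disCoeff x H)) w₂ V r).run y).toOuterMeasure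
        {p | ¬ IsApproxClassifier x y H ε p.1} ≤ ENNReal.ofReal (j * q₁ + q₂) := by
  have hempty : ∀ (V : Set (𝒳 → Bool)) (r : ℝ), V ⊆ H → k₀ ∈ V → ¬ (disRegion x V).Nonempty →
      ((loop x m₁ m₂ (1 / (16 * disCoeff x H)) w₂ V r).run y).toOuterMeasure
        {p | ¬ IsApproxClassifier x y H ε p.1} = 0 := by
    intro V r hVH hk₀ hD
    rw [loop, dif_neg hD, LabelAlg.run, PMF.toOuterMeasure_pure_apply, if_neg]
    rw [Set.mem_ofPred_eq, not_not]
    have hmem : (Classical.epsilon fun h => h ∈ V) ∈ V := Classical.epsilon_spec (p := (· ∈ V))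
      ⟨k₀, hk₀⟩
    refine ⟨hVH hmem, fun h' hh' => ?_⟩
    set h := Classical.epsilon fun h => h ∈ V
    have heq : err x y univ h = err x y univ k₀ := by
      unfold err
      congr 3
      refine filter_congr fun i _ => ?_
      have : h (x i) = k₀ (x i) := by
        by_contra hne
        exact hD ⟨i, (mem_disRegion x V i).2 ⟨h, hmem, k₀, hk₀, hne⟩⟩
      rw [this]
    rw [heq]
    have h1 := hmin h' hh'
    have h2 := err_nonneg x y univ h'
    nlinarith
  -- `j` counts the halvings still possible: at `j = 0`, `n * r < 1` contradicts any remaining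
  -- disagreement.
  induction j with
  | zero =>
    intro V r hVH hk₀ hr hD hj
    rw [hempty V r hVH hk₀]
    · exact zero_le
    · intro h
      have := hD h
      simp at hj
      linarith
  | succ j ih =>
    intro V r hVH hk₀ hr hD hj
    by_cases hDV : (disRegion x V).Nonempty
    swap
    · rw [hempty V r hVH hk₀ hDV]
      exact zero_le
    have hn : (0 : ℝ) < n := by
      obtain ⟨i, -⟩ := hDV
      exact_mod_cast i.pos
    have hkD : ∀ h ∈ V, err x y (disRegion x V) k₀ ≤ err x y (disRegion x V) h := by
      intro h hh
      have h1 := mul_err_sub_mul_err x y hh hk₀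
      have h2 := mul_le_mul_of_nonneg_left (hmin h (hVH hh)) hn.le
      have hM : (0 : ℝ) < (disRegion x V).card := by exact_mod_cast card_pos.2 hDV
      exact le_of_mul_le_mul_left (by linarith) hM
    have hsplit : ENNReal.ofReal (((j + 1 : ℕ) : ℝ) * q₁ + q₂) =
        ENNReal.ofReal q₁ + ENNReal.ofReal (j * q₁ + q₂) := by
      rw [← ENNReal.ofReal_add hq₁ (by positivity)]
      congr 1
      push_cast
      ring
    rw [loop, dif_pos hDV, hsplit]
    refine drawAndQuery_toOuterMeasure_le y _ _ _ (fun h => ¬ IsApproxClassifier x y H ε h) _ _ _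
      (hs₁ V hVH hDV) fun T hT => ?_
    simp only [Set.mem_ofPred_eq, not_exists, not_and, not_lt] at hT
    have hT1 : ∀ h ∈ V, |err x y T h - err x y (disRegion x V) h| ≤
        1 / (16 * disCoeff x H) / 2 := by
      intro h hh
      refine (hT h hh).trans_eq ?_
      rw [div_div]
      ring_nf
    rw [prune_labelTable]
    split_ifs with hrad
    -- This branch returns, so the final estimation is charged once, and the allowance `j * q₁` for
    -- later rounds is dropped.
    · refine (drawAndQuery_toOuterMeasure_le y _ _ _
        (fun h => ¬ IsApproxClassifier x y H ε h) _ _ 0 (hs₂ V hVH hDV) fun T' hT' => ?_).trans ?_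
      · simp only [Set.mem_ofPred_eq, not_exists, not_and, not_lt] at hT'
        rw [LabelAlg.run, PMF.toOuterMeasure_pure_apply, if_neg]
        rw [Set.mem_ofPred_eq, not_not, argminUB_labelTable]
        exact isApprox_argminUB x y hVH hDV hk₀ hmin hε hr T T' hT1 hT' hrad _
      · rw [add_zero]
        refine ENNReal.ofReal_le_ofReal ?_
        have : 0 ≤ (j : ℝ) * q₁ := by positivity
        linarith
    · have hsub : prune x V y T (1 / (16 * disCoeff x H)) ⊆ V := fun h hh => hh.1
      have hk₁ := mem_prune x y T (disRegion x V) _ hT1 hk₀ hkD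
      refine ih _ _ (hsub.trans hVH) hk₁ (card_disRegion_le_radius x (hsub.trans hVH) ⟨_, hk₁⟩)
        (one_le_mul_radius x _) ?_
      push Not at hrad
      have := mul_le_mul_of_nonneg_left hrad hn.le
      rw [pow_succ] at hj
      linarith

lemma exists_of_mem_support_drawAndQuery {α : Type*} (y : Fin n → Bool) (R : Finset (Fin n))
    (m : ℕ) (k : Finset (Fin n) → (Fin n → Bool) → LabelAlg (Fin n) α) (p : α × ℕ)
    (hp : p ∈ ((drawAndQuery R m k).run y).support) :
    ∃ T : Finset (Fin n), ∃ p' ∈ ((k T (labelTable y T)).run y).support, p.2 ≤ p'.2 + m := by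
  rw [drawAndQuery_run, PMF.mem_support_bind_iff] at hp
  obtain ⟨T, hT, hp⟩ := hp
  rw [PMF.mem_support_map_iff] at hp
  obtain ⟨p', hp', rfl⟩ := hp
  refine ⟨T, p', hp', ?_⟩
  rw [uniformSubset, PMF.mem_support_uniformOfFinset_iff, mem_powersetCard] at hT
  have := hT.2
  dsimp only
  omega

/-- No label is queried when all candidates agree. -/
lemma loop_queries_eq_zero (x : Fin n → 𝒳) (y : Fin n → Bool) (m₁ m₂ : ℕ) (w₁ w₂ : ℝ)
    (V : Set (𝒳 → Bool)) (r : ℝ) (hD : ¬ (disRegion x V).Nonempty) (p : (𝒳 → Bool) × ℕ)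
    (hp : p ∈ ((loop x m₁ m₂ w₁ w₂ V r).run y).support) : p.2 = 0 := by
  rw [loop, dif_neg hD, LabelAlg.run, PMF.mem_support_pure_iff] at hp
  rw [hp]

/-- The number of label queries of the loop. -/
theorem loop_queries_le (x : Fin n → 𝒳) (y : Fin n → Bool) (m₁ m₂ : ℕ) (w₁ w₂ : ℝ) (j : ℕ) :
    ∀ (V : Set (𝒳 → Bool)) (r : ℝ), ((disRegion x V).Nonempty → 1 ≤ n * r) → n * r < 2 ^ j →
      ∀ p ∈ ((loop x m₁ m₂ w₁ w₂ V r).run y).support, p.2 ≤ j * m₁ + m₂ := by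
  induction j with
  | zero =>
    intro V r hD hj p hp
    rw [loop_queries_eq_zero x y m₁ m₂ w₁ w₂ V r _ p hp]
    · exact Nat.zero_le _
    · intro h
      have := hD h
      simp at hj
      linarith
  | succ j ih =>
    intro V r hD hj p hp
    by_cases hDV : (disRegion x V).Nonempty
    swap
    · rw [loop_queries_eq_zero x y m₁ m₂ w₁ w₂ V r hDV p hp]
      exact Nat.zero_le _
    rw [loop, dif_pos hDV] at hp
    obtain ⟨T, p', hp', hle⟩ := exists_of_mem_support_drawAndQuery y _ _ _ p hp
    rw [add_mul, one_mul]
    split_ifs at hp' with hrad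
    · obtain ⟨T', p'', hp'', hle'⟩ := exists_of_mem_support_drawAndQuery y _ _ _ p' hp'
      rw [LabelAlg.run, PMF.mem_support_pure_iff] at hp''
      rw [hp''] at hle'
      dsimp only at hle'
      omega
    · have := ih _ _ (one_le_mul_radius x _) (by
        push Not at hrad
        have := mul_le_mul_of_nonneg_left hrad (Nat.cast_nonneg (α := ℝ) n)
        rw [pow_succ] at hj
        linarith) p' hp'
      omega

/-! ### Numerical estimates and assembly -/

lemma disCoeff_eq_zero (x : Fin n → 𝒳) (H : Set (𝒳 → Bool)) (hD : ¬ (disRegion x H).Nonempty) :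
    disCoeff x H = 0 := by
  have h : ∀ h r, disRegion x (hypBall x H h r) = ∅ := by
    intro h r
    rw [not_nonempty_iff_eq_empty] at hD
    rw [← subset_empty, ← hD]
    exact disRegion_mono x fun k hk => hk.1
  simp [disCoeff, disCoeffAt, h]

lemma ofReal_lt_toOuterMeasure {α : Type*} (p : PMF α) (S : Set α) (δ : ℝ) (hδ : 0 < δ)
    (hδ1 : δ < 1) (h : p.toOuterMeasure Sᶜ ≤ ENNReal.ofReal (δ / 2)) :
    ENNReal.ofReal (1 - δ) < p.toOuterMeasure S := by
  have h1 : p.toOuterMeasure S + p.toOuterMeasure Sᶜ = 1 := by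
    rw [PMF.toOuterMeasure_apply, PMF.toOuterMeasure_apply, ← ENNReal.tsum_add, ← p.tsum_coe]
    refine tsum_congr fun a => ?_
    exact congrFun (Set.indicator_self_add_compl S p) a
  by_contra hcon
  push Not at hcon
  have h2 : (1 : ENNReal) ≤ ENNReal.ofReal (1 - δ / 2) := by
    rw [← h1]
    refine (add_le_add hcon h).trans_eq ?_
    rw [← ENNReal.ofReal_add (by linarith) (by linarith)]
    congr 1
    ring
  rw [ENNReal.one_le_ofReal] at h2
  linarith

lemma natLog_add_one_le_logb (n : ℕ) (hn : 0 < n) :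
    ((Nat.log 2 n + 1 : ℕ) : ℝ) ≤ Real.logb 2 (2 * n) := by
  have hn' : (n : ℝ) ≠ 0 := by exact_mod_cast hn.ne'
  rw [Real.logb_mul (by norm_num) hn', Real.logb_self_eq_one (by norm_num)]
  have := Real.natLog_le_logb n 2
  push_cast at this ⊢
  linarith

/-- For `n ≥ 3` the iterated logarithm is bounded below by a positive constant, which lets the query
bound absorb additive constants. Since `Real.log (Real.log 3)` is only about `0.094`, `Real.log 3`
is first estimated through `3 / Real.exp 1`. -/
lemma one_twelfth_le_log_log (n : ℕ) (hn : 3 ≤ n) :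
    1 ≤ Real.log n ∧ 1 / 12 ≤ Real.log (Real.log n) := by
  have h3 : (3 : ℝ) ≤ n := by exact_mod_cast hn
  have he := Real.exp_one_lt_d9
  have h1 : 1.0938 ≤ Real.log n := by
    have e1 : Real.log 3 = 1 + Real.log (3 / Real.exp 1) := by
      rw [Real.log_div (by norm_num) (Real.exp_pos 1).ne', Real.log_exp]; ring
    have e2 := Real.one_sub_inv_le_log_of_pos (show 0 < 3 / Real.exp 1 by positivity)
    rw [inv_div] at e2
    have e3 : Real.log 3 ≤ Real.log n := Real.log_le_log (by norm_num) h3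
    linarith
  refine ⟨by linarith, ?_⟩
  have h2 := Real.one_sub_inv_le_log_of_pos (show 0 < Real.log n by linarith)
  have h4 : (Real.log n)⁻¹ ≤ 11 / 12 := by
    rw [inv_le_comm₀ (by linarith) (by norm_num)]
    norm_num at h1 ⊢
    linarith
  linarith

/-- The sample sizes of the algorithm meet the claimed bound on the number of label queries. -/
lemma query_bound (n d k m₁ m₂ : ℕ) (hn : 3 ≤ n) (θ ε δ : ℝ) (hθ : 1 ≤ θ) (hε : 0 < ε)
    (hε1 : ε ≤ 1) (hδ : 0 < δ) (hδ1 : δ < 1) (hk : (k : ℝ) ≤ Real.logb 2 (2 * n))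
    (hm₁ : (m₁ : ℝ) ≤ 2 * 10 ^ 8 * θ ^ 2 * (d * Real.log θ +
      Real.log (1 / (δ / (2 * Real.logb 2 (2 * n))))) + 10 ^ 7 + 1)
    (hm₂ : (m₂ : ℝ) ≤ 2 * 10 ^ 8 * θ ^ 2 / ε ^ 2 * (d * Real.log (θ / ε) +
      Real.log (1 / δ)) + 10 ^ 7 + 1) :
    ((k * m₁ + m₂ : ℕ) : ℝ) ≤ 2 * 10 ^ 10 * (Real.log n * θ ^ 2 * (d * Real.log θ +
      Real.log (Real.log n / δ)) + θ ^ 2 / ε ^ 2 * (d * Real.log (θ / ε) + Real.log (1 / δ))) := by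
  obtain ⟨hL, hℓ0⟩ := one_twelfth_le_log_log n hn
  have hn0 : (n : ℝ) ≠ 0 := by
    have : n ≠ 0 := by omega
    exact_mod_cast this
  set L := Real.log n with hLdef
  set K := Real.logb 2 (2 * n) with hK
  have hs : 0 ≤ Real.log (1 / δ) := Real.log_nonneg (by rw [le_div_iff₀ hδ]; linarith)
  set s := Real.log (1 / δ) with hsdef
  have hs' : s = - Real.log δ := by rw [hsdef, one_div, Real.log_inv]
  have hA : 0 ≤ d * Real.log θ := mul_nonneg (Nat.cast_nonneg d) (Real.log_nonneg hθ)
  have hθε : 1 ≤ θ / ε := by rw [le_div_iff₀ hε]; linarith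
  have hB : 0 ≤ d * Real.log (θ / ε) := mul_nonneg (Nat.cast_nonneg d) (Real.log_nonneg hθε)
  set A := d * Real.log θ
  set B := d * Real.log (θ / ε)
  have hKeq : K = 1 + L / Real.log 2 := by
    rw [hK, Real.logb_mul (by norm_num) hn0, Real.logb_self_eq_one (by norm_num), Real.logb]
  have hl2 := Real.log_two_gt_d9
  have hl2' := Real.log_two_lt_d9
  have hK2 : K ≤ 5 / 2 * L := by
    have : L / Real.log 2 ≤ 3 / 2 * L := by
      rw [div_le_iff₀ (by linarith)]
      nlinarith
    rw [hKeq]; linarith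
  have hK1 : 1 ≤ K := by
    have : 0 ≤ L / Real.log 2 := div_nonneg (by linarith) (by linarith)
    rw [hKeq]; linarith
  set ℓ := Real.log (L / δ) with hℓdef
  have hℓ : ℓ = Real.log L + s := by
    rw [hℓdef, Real.log_div (by linarith) hδ.ne', hs']; ring
  -- The surplus `3 * Real.log 2` is below `25 / 12`, hence at most `25 * ℓ`.
  have hδ' : Real.log (1 / (δ / (2 * K))) ≤ 26 * ℓ := by
    rw [one_div_div, Real.log_div (by linarith) hδ.ne']
    have e1 : Real.log (2 * K) ≤ Real.log (2 ^ 3 * L) :=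
      Real.log_le_log (by linarith) (by linarith)
    rw [Real.log_mul (x := 2 ^ 3) (by norm_num) (by linarith), Real.log_pow] at e1
    push_cast at e1
    linarith
  have hℓ1 : 1 / 12 ≤ ℓ := by linarith
  have hθ2 : 1 ≤ θ ^ 2 := by nlinarith
  set X := θ ^ 2 * (A + ℓ) with hX
  have hX1 : 1 ≤ 12 * X := by nlinarith
  have hm₁' : (m₁ : ℝ) ≤ 54 * 10 ^ 8 * X := by
    have e1 : θ ^ 2 * (A + Real.log (1 / (δ / (2 * K)))) ≤ 26 * X := by
      rw [hX]
      have := mul_le_mul_of_nonneg_left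
        (show A + Real.log (1 / (δ / (2 * K))) ≤ 26 * (A + ℓ) by linarith)
        (show 0 ≤ θ ^ 2 by positivity)
      linarith
    linarith
  have hkm : (k : ℝ) * m₁ ≤ (5 / 2 * L) * (54 * 10 ^ 8 * X) :=
    mul_le_mul (hk.trans hK2) hm₁' (Nat.cast_nonneg _) (by linarith)
  have hLX : X ≤ L * X := by nlinarith
  have hm₂' : (m₂ : ℝ) ≤ 2 * 10 ^ 8 * (θ ^ 2 / ε ^ 2 * (B + s)) + 12 * (10 ^ 7 + 1) * (L * X) := by
    have e1 : 2 * 10 ^ 8 * θ ^ 2 / ε ^ 2 * (B + s) = 2 * 10 ^ 8 * (θ ^ 2 / ε ^ 2 * (B + s)) := by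
      ring
    rw [e1] at hm₂
    linarith
  have hY : 0 ≤ θ ^ 2 / ε ^ 2 * (B + s) := by positivity
  push_cast
  rw [show L * θ ^ 2 * (A + ℓ) = L * X by rw [hX]; ring]
  linarith

end ActiveLearning

theorem mainTheorem3 :
    ∃ c₁ b₁ c₂ b₂ C : ℝ, 0 < c₁ ∧ 0 < b₁ ∧ 0 < c₂ ∧ 0 < b₂ ∧ 0 < C ∧
      ∀ (𝒳 : Type*) (n : ℕ) (x : Fin n → 𝒳) (y : Fin n → Bool) (H : Set (𝒳 → Bool)) (ε δ : ℝ),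
        0 < n → H.Nonempty → ActiveLearning.vcDim H ≠ ⊤ →
        0 < ε → ε ≤ 1 → 0 < δ → δ < 1 →
        ENNReal.ofReal (1 - δ) <
          ((ActiveLearning.generalAlgorithm c₁ b₁ c₂ b₂ x H ε δ).run y).toOuterMeasure
            {p | ActiveLearning.IsApproxClassifier x y H ε p.1} ∧
        (3 ≤ n →
          ∀ p ∈ ((ActiveLearning.generalAlgorithm c₁ b₁ c₂ b₂ x H ε δ).run y).support,
            (p.2 : ℝ) ≤
              C * (Real.log n * ActiveLearning.disCoeff x H ^ 2 *
                    (((ActiveLearning.vcDim H).toNat : ℝ) * Real.log (ActiveLearning.disCoeff x H)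
                      + Real.log (Real.log n / δ))
                  + ActiveLearning.disCoeff x H ^ 2 / ε ^ 2 *
                    (((ActiveLearning.vcDim H).toNat : ℝ)
                        * Real.log (ActiveLearning.disCoeff x H / ε)
                      + Real.log (1 / δ)))) := by
  open ActiveLearning in
  refine ⟨2 * 10 ^ 8, 10 ^ 7, 2 * 10 ^ 8, 10 ^ 7, 2 * 10 ^ 10, by norm_num, by norm_num,
    by norm_num, by norm_num, by norm_num, ?_⟩
  intro 𝒳 n x y H ε δ hn hHne hH hε hε1 hδ hδ1
  have hθ0 := disCoeff_nonneg x H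
  have hk := natLog_add_one_le_logb n hn
  set k := Nat.log 2 n + 1 with hkdef
  have hk1 : (1 : ℝ) ≤ k := by rw [hkdef]; push_cast; linarith [Nat.cast_nonneg (α := ℝ) (Nat.log 2 n)]
  have hnk : (n : ℝ) * 1 < 2 ^ k := by
    rw [mul_one]
    exact_mod_cast Nat.lt_pow_succ_log_self (by norm_num) n
  have hn1 : (1 : ℝ) ≤ n := by exact_mod_cast hn
  have hδ'0 : 0 < δ / (2 * Real.logb 2 (2 * n)) := by
    have : 0 < Real.logb 2 (2 * n) := by linarith
    positivity
  have hδ'1 : δ / (2 * Real.logb 2 (2 * n)) ≤ 1 := by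
    rw [div_le_one (by linarith)]
    linarith
  unfold generalAlgorithm
  dsimp only
  refine ⟨ofReal_lt_toOuterMeasure _ _ δ hδ hδ1 ?_, ?_⟩
  · obtain ⟨k₀, hk₀, hmin⟩ := exists_min_err x y Finset.univ hHne
    refine (loop_failure_le x y H _ _ ε (δ / (2 * Real.logb 2 (2 * n)) / 3) (δ / 3) hε (by positivity)
      (by positivity) k₀ hmin (fun V hV hD => ?_) (fun V hV hD => ?_) _ k H 1 subset_rfl hk₀ ?_
      (fun _ => by linarith) hnk).trans (ENNReal.ofReal_le_ofReal ?_)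
    · refine uniformSubset_deviation_le x y hV hH hD 1 _ one_pos le_rfl hδ'0 hδ'1 _ ?_
      rw [one_pow, div_one, div_one]
      exact Nat.le_ceil _
    · exact uniformSubset_deviation_le x y hV hH hD ε δ hε hε1 hδ hδ1.le _ (Nat.le_ceil _)
    · by_cases hD : (disRegion x H).Nonempty
      · have h1 := one_le_disCoeff x H hD
        have h2 : ((disRegion x H).card : ℝ) ≤ n := by exact_mod_cast card_disRegion_le x H
        nlinarith
      · rw [Finset.not_nonempty_iff_eq_empty.1 hD, Finset.card_empty, Nat.cast_zero]
        positivity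
    -- At most `log₂ (2n)` rounds cost `δ / 6` in all and the final estimation `δ / 3`. The sum `δ /
    -- 2` leaves the slack for the strict inequality.
    · have h1 : (k : ℝ) * (δ / (2 * Real.logb 2 (2 * n)) / 3) ≤ δ / 6 := by
        calc (k : ℝ) * (δ / (2 * Real.logb 2 (2 * n)) / 3)
            ≤ Real.logb 2 (2 * n) * (δ / (2 * Real.logb 2 (2 * n)) / 3) := by gcongr
          _ = δ / 6 := by
            have : Real.logb 2 (2 * n) ≠ 0 := by linarith
            field_simp
            norm_num
      linarith
  · intro hn3 p hp
    by_cases hD : (disRegion x H).Nonempty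
    · have hθ := one_le_disCoeff x H hD
      have hs : 0 ≤ Real.log (1 / δ) := Real.log_nonneg (by rw [le_div_iff₀ hδ]; linarith)
      have hs' : 0 ≤ Real.log (1 / (δ / (2 * Real.logb 2 (2 * n)))) :=
        Real.log_nonneg (by rw [le_div_iff₀ hδ'0]; linarith)
      have hlθ := Real.log_nonneg hθ
      have hlθε : 0 ≤ Real.log (disCoeff x H / ε) :=
        Real.log_nonneg (by rw [le_div_iff₀ hε]; linarith)
      refine (Nat.cast_le.2 (loop_queries_le x y _ _ _ _ k H 1 (fun _ => by linarith) hnk p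
        hp)).trans ?_
      exact query_bound n _ k _ _ hn3 _ ε δ hθ hε hε1 hδ hδ1 hk
        (Nat.ceil_lt_add_one (by positivity)).le (Nat.ceil_lt_add_one (by positivity)).le
    · rw [loop_queries_eq_zero x y _ _ _ _ H 1 hD p hp, disCoeff_eq_zero x H hD]
      simp
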